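/- **Model.** Consider the uplink of a network with $L$ cells, $K$ users per cell and $N$ antennas per base station (BS), during one coherence block with channel uses $1,\dots,T$. Let $\lambda_{jlk}>0$, $\sigma^2>0$, $\xi\ge 1$, $\kappa\ge 0$, $\delta\ge 0$. Fix BS $j$. The channels $\mathbf h_{jlk}=(h_{jlk}^{(1)},\dots,h_{jlk}^{(N)})^T\sim\mathcal{CN}(\mathbf 0,\lambda_{jlk}\mathbf I_N)$ are independent over $l,k$. User $k$ of cell $l$ sends $x_{lk}(t)$ at channel use $t$: for $t\le B$ these are deterministic pilot symbols, $\tilde{\mathbf x}_{lk}=(x_{lk}(1),\dots,x_{lk}(B))^T\in\mathbb C^B$ (arbitrary), and for $B<t\le T$ they are data symbols with $\mathbb E|x_{lk}(t)|^2=p_{lk}$. The received signal is $$\mathbf y_j(t)=\mathbf D_{\phi_j(t)}\sum_{l=1}^L\sum_{k=1}^K\mathbf h_{jlk}x_{lk}(t)+\boldsymbol\upsilon_j(t)+\sqrt{\xi}\,\mathbf n_j(t),\qquad \mathbf D_{\phi_j(t)}=\mathrm{diag}(e^{\imath\phi_{j1}(t)},\dots,e^{\imath\phi_{jN}(t)}).$$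 Here the phase-drift processes $\phi_{jn}$ are independent over the antennas $n$, each $\phi_{jn}(t+1)-\phi_{jn}(t)\sim\mathcal N(0,\delta)$ being independent of $\phi_{jn}(1),\dots,\phi_{jn}(t)$; the thermal noise vectors $\mathbf n_j(t)\sim\mathcal{CN}(\mathbf 0,\sigma^2\mathbf I_N)$ are independent over $t$; channels, phase drifts and thermal noise are mutually independent; and, given these three, the distortion noise vectors $\boldsymbol\upsilon_j(t)$ are independent over $t$ with $\boldsymbol\upsilon_j(t)\sim\mathcal{CN}(\mathbf 0,\boldsymbol\Upsilon_j(t))$, $\boldsymbol\Upsilon_j(t)=\kappa^2\sum_{l,k}\mathbb E\{|x_{lk}(t)|^2\}\,\mathrm{diag}(|h_{jlk}^{(1)}|^2,\dots,|h_{jlk}^{(N)}|^2)$. Put $\mathbf h_{jlk}(t)=\mathbf D_{\phi_j(t)}\mathbf h_{jlk}$, $\boldsymbol\psi_j=(\mathbf y_j(1)^T,\dots,\mathbf y_j(B)^T)^T$, $\mathbf D_\delta(t)=\mathrm{diag}(e^{-\frac{\delta}{2}(t-1)},\dots,e^{-\frac{\delta}{2}(t-B)})$, $$[\mathbf X_{lm}]_{i_1,i_2}=\begin{cases}|x_{lm}(i_1)|^2(1+\kappa^2),&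 i_1=i_2,\\ x_{lm}(i_1)x_{lm}^*(i_2)e^{-\frac{\delta}{2}|i_1-i_2|},& i_1\ne i_2,\end{cases}\qquad \boldsymbol\Psi_j=\sum_{l,m}\lambda_{jlm}\mathbf X_{lm}+\sigma^2\xi\,\mathbf I_B .$$ Let $\hat{\mathbf h}_{jlm}(t)=\mathbb E\{\mathbf h_{jlm}(t)\boldsymbol\psi_j^H\}\,(\mathbb E\{\boldsymbol\psi_j\boldsymbol\psi_j^H\})^{-1}\boldsymbol\psi_j$ be the LMMSE estimate of $\mathbf h_{jlm}(t)$ from $\boldsymbol\psi_j$. **Theorem.** Let $1\le t\le T$ and $t\ge B$. Then $\boldsymbol\Psi_j$ and $\mathbb E\{\boldsymbol\psi_j\boldsymbol\psi_j^H\}$ are invertible and $\hat{\mathbf h}_{jlm}(t)=(\lambda_{jlm}\tilde{\mathbf x}_{lm}^H\mathbf D_\delta(t)\boldsymbol\Psi_j^{-1}\otimes\mathbf I_N)\boldsymbol\psi_j$ for all $l,m$. For the maximum ratio combining filter $\mathbf v=\hat{\mathbf h}_{jjk}(t)$, the following expectations are of integrable random variables, and $$\mathbb E\{\|\mathbf v\|^2\}=N\lambda_{jjk}^2\,\tilde{\mathbf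 x}_{jk}^H\mathbf D_\delta(t)\boldsymbol\Psi_j^{-1}\mathbf D_\delta(t)^H\tilde{\mathbf x}_{jk},\qquad \mathbb E\{\mathbf v^H\mathbf h_{jjk}(t)\}=\mathbb E\{\|\mathbf v\|^2\},$$ and, for all $l,m$, $$\mathbb E\{|\mathbf v^H\mathbf h_{jlm}(t)|^2\}=\lambda_{jlm}\mathbb E\{\|\mathbf v\|^2\}+N\lambda_{jjk}^2\lambda_{jlm}^2\,\tilde{\mathbf x}_{jk}^H\mathbf D_\delta(t)\boldsymbol\Psi_j^{-1}\mathbf X_{lm}\boldsymbol\Psi_j^{-1}\mathbf D_\delta(t)^H\tilde{\mathbf x}_{jk}+N(N-1)\lambda_{jjk}^2\lambda_{jlm}^2\,|\tilde{\mathbf x}_{jk}^H\mathbf D_\delta(t)\boldsymbol\Psi_j^{-1}\mathbf D_\delta(t)^H\tilde{\mathbf x}_{lm}|^2 .$$ If moreover $t>B$, then $$\mathbb E\{|\mathbf v^H\boldsymbol\upsilon_j(t)|^2\}=\kappa^2\sum_{l,m}p_{lm}\lambda_{jlm}\mathbb E\{\|\mathbf v\|^2\}+\kappa^2\sum_{l,m}p_{lm}N\lambda_{jjk}^2\lambda_{jlm}^2\,\tilde{\mathbf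 x}_{jk}^H\mathbf D_\delta(t)\boldsymbol\Psi_j^{-1}\mathbf X_{lm}\boldsymbol\Psi_j^{-1}\mathbf D_\delta(t)^H\tilde{\mathbf x}_{jk}.$$ -/

import Mathlib

open MeasureTheory ProbabilityTheory
open scoped NNReal Matrix Kronecker

/-- The circularly symmetric complex Gaussian law `CN(0, v)` on `ℂ`: independent real and imaginary
parts, each with law `N(0, v / 2)`. -/
noncomputable def circGaussian (v : ℝ≥0) : Measure ℂ :=
  ((gaussianReal 0 (v / 2)).prod (gaussianReal 0 (v / 2))).map
    (fun z : ℝ × ℝ => (⟨z.1, z.2⟩ : ℂ))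

/-- The matrix `E[u wᴴ]` of two random complex vectors. -/
noncomputable def crossMoment {Ω ι ι' : Type*} [MeasurableSpace Ω] (P : Measure Ω)
    (u : Ω → ι → ℂ) (w : Ω → ι' → ℂ) : Matrix ι ι' ℂ :=
  Matrix.of fun a b => ∫ ω, u ω a * star (w ω b) ∂P

/-- The linear MMSE estimate `E[u wᴴ] (E[w wᴴ])⁻¹ w` of a zero-mean random vector `u` from a
zero-mean observation `w`. -/
noncomputable def lmmse {Ω ι ι' : Type*} [MeasurableSpace Ω] [Fintype ι'] [DecidableEq ι']
    (P : Measure Ω) (u : Ω → ι → ℂ) (w : Ω → ι' → ℂ) (ω : Ω) : ι → ℂ :=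
  (crossMoment P u w * (crossMoment P w w)⁻¹) *ᵥ w ω

/-- The deterministic parameters of an uplink with `L` cells, `K` users per cell and pilot
sequences of length `B`. -/
structure UplinkParams (L K B : ℕ) where
  /-- `lam j l k` is the average attenuation from user `k` of cell `l` to base station `j` -/
  lam : Fin L → Fin L → Fin K → ℝ
  lam_pos : ∀ j l k, 0 < lam j l k
  /-- transmit power of user `k` of cell `l` during data transmission -/
  p : Fin L → Fin K → ℝ
  /-- `pilot l k i` is the pilot symbol sent at channel use `i + 1` -/
  pilot : Fin L → Fin K → Fin B → ℂ
  /-- standard deviation of the thermal noise -/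
  sigma : ℝ
  sigma_pos : 0 < sigma
  /-- noise amplification factor -/
  xi : ℝ
  one_le_xi : 1 ≤ xi
  /-- error vector magnitude -/
  kappa : ℝ
  kappa_nonneg : 0 ≤ kappa
  /-- variance of the phase-drift innovations -/
  delta : ℝ≥0

namespace UplinkParams

variable {L K B : ℕ} (S : UplinkParams L K B)

/-- `D_δ(t) = diag(exp(-δ(t-1)/2), …, exp(-δ(t-B)/2))`. -/
noncomputable def D (t : ℕ) : Matrix (Fin B) (Fin B) ℂ :=
  Matrix.diagonal fun i =>
    ((Real.exp (-((S.delta : ℝ) / 2) * ((t : ℝ) - ((i : ℕ) + 1 : ℝ))) : ℝ) : ℂ)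

/-- The matrix `X_{lm}`. -/
noncomputable def X (l : Fin L) (m : Fin K) : Matrix (Fin B) (Fin B) ℂ :=
  Matrix.of fun i₁ i₂ =>
    if i₁ = i₂ then ((‖S.pilot l m i₁‖ ^ 2 * (1 + S.kappa ^ 2) : ℝ) : ℂ)
    else S.pilot l m i₁ * star (S.pilot l m i₂) *
      ((Real.exp (-((S.delta : ℝ) / 2) * |((i₁ : ℕ) : ℝ) - ((i₂ : ℕ) : ℝ)|) : ℝ) : ℂ)

/-- `Ψ_j = ∑_{l,m} λ_{jlm} X_{lm} + σ² ξ I_B`. -/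
noncomputable def Psi (j : Fin L) : Matrix (Fin B) (Fin B) ℂ :=
  ∑ l, ∑ m, (S.lam j l m : ℂ) • S.X l m + ((S.sigma ^ 2 * S.xi : ℝ) : ℂ) • 1

end UplinkParams

/-- The random quantities of one coherence block. Channel uses are numbered `1, 2, …`. -/
structure UplinkSignals (L K N : ℕ) (Ω : Type*) where
  /-- `h j l k n` is the channel from user `k` of cell `l` to antenna `n` of base station `j` -/
  h : Fin L → Fin L → Fin K → Fin N → Ω → ℂ
  /-- `x l k t` is the symbol sent by user `k` of cell `l` at channel use `t` -/
  x : Fin L → Fin K → ℕ → Ω → ℂ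
  /-- `phi j n t` is the phase drift at antenna `n` of base station `j` -/
  phi : Fin L → Fin N → ℕ → Ω → ℝ
  /-- `noise j t n` is the thermal noise at antenna `n` of base station `j` -/
  noise : Fin L → ℕ → Fin N → Ω → ℂ
  /-- `ups j t n` is the distortion noise at antenna `n` of base station `j` -/
  ups : Fin L → ℕ → Fin N → Ω → ℂ

namespace UplinkSignals

variable {L K N B : ℕ} {Ω : Type*} [MeasurableSpace Ω] (M : UplinkSignals L K N Ω)

/-- The channels to base station `j`. -/
def chan (j : Fin L) (ω : Ω) : Fin L → Fin K → Fin N → ℂ := fun l k n => M.h j l k n ω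

/-- The phase drifts at antenna `n` of base station `j` during channel uses `1, …, T`. -/
def phase (T : ℕ) (j : Fin L) (n : Fin N) (ω : Ω) : Fin T → ℝ := fun s => M.phi j n (s + 1) ω

/-- The thermal noise at base station `j` during channel uses `1, …, T`. -/
def noiseBlock (T : ℕ) (j : Fin L) (ω : Ω) : Fin T × Fin N → ℂ :=
  fun i => M.noise j (i.1 + 1) i.2 ω

/-- The distortion noise at base station `j` during channel uses `1, …, T`. -/
def upsBlock (T : ℕ) (j : Fin L) (ω : Ω) : Fin T × Fin N → ℂ :=
  fun i => M.ups j (i.1 + 1) i.2 ω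

/-- The conditional variance `κ² ∑_{l,k} E|x_{lk}(t)|² |c_{lkn}|²` of the distortion noise at
antenna `n` and channel use `t` when the channels to the base station are `c`. -/
noncomputable def upsVar (P : Measure Ω) (S : UplinkParams L K B) (t : ℕ)
    (c : Fin L → Fin K → Fin N → ℂ) (n : Fin N) : ℝ :=
  S.kappa ^ 2 * ∑ l, ∑ k, (∫ ω, ‖M.x l k t ω‖ ^ 2 ∂P) * ‖c l k n‖ ^ 2

/-- The effective channel `h_{jlk}(t) = D_{φ_j(t)} h_{jlk}`. -/
noncomputable def effChan (j l : Fin L) (k : Fin K) (t : ℕ) (ω : Ω) : Fin N → ℂ :=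
  fun n => Complex.exp (Complex.I * (M.phi j n t ω : ℂ)) * M.h j l k n ω

/-- The distortion noise vector `υ_j(t)`. -/
def upsVec (j : Fin L) (t : ℕ) (ω : Ω) : Fin N → ℂ := fun n => M.ups j t n ω

/-- The received signal `y_j(t) = D_{φ_j(t)} ∑_l H_{jl} x_l(t) + υ_j(t) + √ξ n_j(t)`. -/
noncomputable def received (S : UplinkParams L K B) (j : Fin L) (t : ℕ) (ω : Ω) : Fin N → ℂ :=
  fun n => Complex.exp (Complex.I * (M.phi j n t ω : ℂ)) *
      (∑ l, ∑ k, M.h j l k n ω * M.x l k t ω) +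
    M.ups j t n ω + ((Real.sqrt S.xi : ℝ) : ℂ) * M.noise j t n ω

/-- The stacked pilot observation `ψ_j`, made of `y_j(1), …, y_j(B)`. -/
noncomputable def psi (S : UplinkParams L K B) (j : Fin L) (ω : Ω) : Fin B × Fin N → ℂ :=
  fun i => M.received S j (i.1 + 1) ω i.2

/-- The LMMSE estimate of the effective channel `h_{jlk}(t)` from `ψ_j`. -/
noncomputable def hhat (P : Measure Ω) (S : UplinkParams L K B) (j l : Fin L) (k : Fin K)
    (t : ℕ) : Ω → Fin N → ℂ :=
  lmmse P (M.effChan j l k t) (M.psi S j)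

/-- The MRC filter `v_{jk}(t)`. -/
noncomputable def mrc (P : Measure Ω) (S : UplinkParams L K B) (j : Fin L) (k : Fin K)
    (t : ℕ) : Ω → Fin N → ℂ :=
  M.hhat P S j j k t

end UplinkSignals

/-- The row vector `λ_{jlk} x̃_{lk}ᴴ D_δ(t) Ψ_j⁻¹` as a `1 × B` matrix. -/
noncomputable def UplinkParams.filterRow {L K B : ℕ} (S : UplinkParams L K B) (j l : Fin L)
    (k : Fin K) (t : ℕ) : Matrix Unit (Fin B) ℂ :=
  (S.lam j l k : ℂ) • ((Matrix.replicateRow Unit (star (S.pilot l k))) * S.D t * (S.Psi j)⁻¹)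

/-- The uplink model with hardware-constrained base stations on the probability space `(Ω, P)`,
for a coherence block of `T` channel uses of which the first `B` carry pilots. -/
structure IsHardwareUplink {L K N B : ℕ} {Ω : Type*} [MeasurableSpace Ω] (P : Measure Ω)
    [IsProbabilityMeasure P] (T : ℕ) (S : UplinkParams L K B) (M : UplinkSignals L K N Ω) :
    Prop where
  measurable_h : ∀ j l k n, Measurable (M.h j l k n)
  measurable_phi : ∀ j n t, Measurable (M.phi j n t)
  measurable_noise : ∀ j t n, Measurable (M.noise j t n)
  measurable_ups : ∀ j t n, Measurable (M.ups j t n)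
  /-- pilots are deterministic -/
  x_pilot : ∀ l k (i : Fin B) ω, M.x l k (i + 1) ω = S.pilot l k i
  /-- data symbols are random with full power -/
  x_data_memLp : ∀ l k t, B < t → t ≤ T → MemLp (M.x l k t) 2 P
  x_data_power : ∀ l k t, B < t → t ≤ T → ∫ ω, ‖M.x l k t ω‖ ^ 2 ∂P = S.p l k
  /-- independent Rayleigh fading -/
  law_h : ∀ j l k n, HasLaw (M.h j l k n) (circGaussian (S.lam j l k).toNNReal) P
  indep_h : ∀ j, iIndepFun (fun (i : Fin L × Fin K × Fin N) => M.h j i.1 i.2.1 i.2.2) P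
  /-- phase drifts: independent Gaussian innovations of variance `δ` -/
  law_phi : ∀ j n t, 1 ≤ t → t + 1 ≤ T →
    HasLaw (fun ω => M.phi j n (t + 1) ω - M.phi j n t ω) (gaussianReal 0 S.delta) P
  indep_innovation : ∀ j n t, 1 ≤ t → t + 1 ≤ T →
    IndepFun (fun ω => M.phi j n (t + 1) ω - M.phi j n t ω) (M.phase t j n) P
  /-- phase drifts at different antennas are independent -/
  indep_phi : ∀ j, iIndepFun (fun n => M.phase T j n) P
  /-- thermal noise -/
  law_noise : ∀ j t n, 1 ≤ t → t ≤ T →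
    HasLaw (M.noise j t n) (circGaussian (S.sigma ^ 2).toNNReal) P
  indep_noise : ∀ j, iIndepFun (fun (i : Fin T × Fin N) => M.noise j (i.1 + 1) i.2) P
  /-- channels, phase drifts and thermal noise are mutually independent -/
  indep_chan : ∀ j, IndepFun (M.chan j)
    (fun ω => ((fun n => M.phase T j n ω), M.noiseBlock T j ω)) P
  indep_phi_noise : ∀ j, IndepFun (fun ω n => M.phase T j n ω) (M.noiseBlock T j) P
  /-- given the channels, phase drifts and thermal noise, the distortion noise is independent over
  antennas and channel uses and has law `CN(0, Υ_j(t))`, `Υ_j(t)` being fixed by the channels -/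
  condLaw_ups : ∀ j,
    ∀ᵐ a ∂(P.map fun ω => (M.chan j ω, (fun n => M.phase T j n ω), M.noiseBlock T j ω)),
      condDistrib (M.upsBlock T j)
        (fun ω => (M.chan j ω, (fun n => M.phase T j n ω), M.noiseBlock T j ω)) P a =
      Measure.pi fun i : Fin T × Fin N =>
        circGaussian (M.upsVar P S (i.1 + 1) a.1 i.2).toNNReal

/-!
The proof replaces the random model by an explicit one and then computes moments.

Given channels, phases and thermal noise, the distortion at antenna `n` and channel use `t` is a
centred complex Gaussian whose variance depends on the channels only. Hence the joint law of all the
variables is the image of a product measure on which the distortion is `√(variance) * z` with `z`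
standard Gaussian and independent of everything else (`map_base_upsBlock`). On that product space
every quantity in the theorem is a sum of products of functions of independent variables, all
having moments of every order, so its integral factors and integrability is automatic
(`integral_signal_mul_star`, `HasAllMoments`).

What remains are moments of each factor. For independent circular Gaussians, invariance under a
quarter turn kills the unbalanced moments, and the balanced fourth moments obey Wick's formula
(`integral_circGaussianPi_fourth`). The phase factors have correlation `exp(-δ|a-b|/2)`, obtained by
adding independent increments (`integral_phasor`). Therefore the pilot observation has covariance
`Ψ ⊗ I` and correlation `λ x̃ᴴ D_δ(t) ⊗ I` with the effective channel, which gives the estimator.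

For the second moments of the filter output, `|vᴴu|²` is expanded over pairs of antennas. Writing
`y(b)` for the observation at one antenna and `h` for a channel coefficient at that antenna, one has
`E[y(b) y(b')* |h|²] = λ Ψ_{bb'} + λ² X_{bb'}` (`integral_received_effChan`): the first term is the
product of the second moments, the second one the excess of the Gaussian fourth moment. Distinct
antennas are independent and contribute a product of correlations, which is the `N (N - 1)` term;
for the distortion noise it vanishes (`integral_received_upsVec`).

Finally `Ψ` is invertible because it is positive definite: the kernel `exp(-δ|a-b|/2)` is a
nonnegative combination of rank-one kernels (`phaseCorr_eq_sum`).
-/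

/-! ### Random variables with moments of every order -/

/-- A complex random variable all of whose absolute moments are finite. -/
def HasAllMoments {Ω : Type*} [MeasurableSpace Ω] (f : Ω → ℂ) (μ : Measure Ω) : Prop :=
  ∀ p : ENNReal, p ≠ ⊤ → MemLp f p μ

namespace HasAllMoments

variable {Ω Ω' : Type*} [MeasurableSpace Ω] [MeasurableSpace Ω'] {μ : Measure Ω} {ν : Measure Ω'}
  {f g : Ω → ℂ}

lemma integrable (hf : HasAllMoments f μ) : Integrable f μ :=
  memLp_one_iff_integrable.mp (hf 1 (by simp))

lemma const [IsFiniteMeasure μ] (c : ℂ) : HasAllMoments (fun _ => c) μ :=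
  fun _ _ => memLp_const c

lemma add (hf : HasAllMoments f μ) (hg : HasAllMoments g μ) :
    HasAllMoments (fun ω => f ω + g ω) μ :=
  fun p hp => (hf p hp).add (hg p hp)

lemma mul (hf : HasAllMoments f μ) (hg : HasAllMoments g μ) :
    HasAllMoments (fun ω => f ω * g ω) μ := fun p hp => by
  have h2 : 2 * p ≠ ⊤ := ENNReal.mul_ne_top (by simp) hp
  have : ENNReal.HolderTriple (2 * p) (2 * p) p := ⟨by
    rw [ENNReal.mul_inv (by simp) (by simp), ← add_mul, ENNReal.inv_two_add_inv_two, one_mul]⟩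
  exact (hg _ h2).mul' (hf _ h2)

lemma const_mul (c : ℂ) (hf : HasAllMoments f μ) : HasAllMoments (fun ω => c * f ω) μ :=
  fun p hp => (hf p hp).const_mul c

lemma star (hf : HasAllMoments f μ) : HasAllMoments (fun ω => Star.star (f ω)) μ :=
  fun p hp => (hf p hp).star

lemma sum {ι : Type*} {s : Finset ι} {F : ι → Ω → ℂ} (h : ∀ i ∈ s, HasAllMoments (F i) μ) :
    HasAllMoments (fun ω => ∑ i ∈ s, F i ω) μ :=
  fun p hp => memLp_finsetSum s fun i hi => h i hi p hp

lemma comp_measurePreserving {T : Ω' → Ω} (hf : HasAllMoments f μ)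
    (hT : MeasurePreserving T ν μ) : HasAllMoments (fun ω => f (T ω)) ν :=
  fun p hp => (hf p hp).comp_measurePreserving hT

lemma mono [IsFiniteMeasure μ] (hg : HasAllMoments g μ) (hf : AEStronglyMeasurable f μ)
    (h : ∀ ω, ‖f ω‖ ≤ ‖g ω‖) : HasAllMoments f μ :=
  fun p hp => (hg p hp).mono hf (Filter.Eventually.of_forall h)

lemma of_bound [IsFiniteMeasure μ] (hf : AEStronglyMeasurable f μ) (c : ℝ)
    (h : ∀ ω, ‖f ω‖ ≤ c) : HasAllMoments f μ :=
  fun _ _ => MemLp.of_bound hf c (Filter.Eventually.of_forall h)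

lemma normSq (hf : HasAllMoments f μ) : Integrable (fun ω => ‖f ω‖ ^ 2) μ :=
  (hf 2 (by simp)).integrable_norm_pow (by norm_num)

end HasAllMoments

/-! ### The circularly symmetric complex Gaussian law -/

lemma gaussianReal_fourth_moment (v : ℝ≥0) : ∫ x, x ^ 4 ∂(gaussianReal 0 v) = 3 * (v : ℝ) ^ 2 := by
  have h := iteratedDeriv_mgf_zero (X := id) (μ := gaussianReal 0 v) (by simp) 4
  have d1 : deriv (fun t : ℝ => Real.exp (0 * t + v * t ^ 2 / 2))
      = fun t => (v * t) * Real.exp (0 * t + v * t ^ 2 / 2) := by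
    funext t
    refine HasDerivAt.deriv ?_
    have := (((hasDerivAt_id t).const_mul (0:ℝ)).add
      ((((hasDerivAt_id t).pow 2).const_mul (v:ℝ)).div_const 2)).exp
    convert! this using 1
    simp; ring
  have dm : ∀ (q q' : ℝ → ℝ), (∀ t, HasDerivAt q (q' t) t) →
      deriv (fun t : ℝ => q t * Real.exp (0 * t + v * t ^ 2 / 2))
      = fun t => (q' t + q t * (v * t)) * Real.exp (0 * t + v * t ^ 2 / 2) := by
    intro q q' hq
    funext t
    refine HasDerivAt.deriv ?_
    have := (((hasDerivAt_id t).const_mul (0:ℝ)).add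
      ((((hasDerivAt_id t).pow 2).const_mul (v:ℝ)).div_const 2)).exp
    convert! (hq t).mul this using 1
    simp; ring
  have e2 : ∀ t : ℝ, HasDerivAt (fun t : ℝ => v * t) (v : ℝ) t := fun t => by
    simpa using (hasDerivAt_id t).const_mul (v:ℝ)
  have e3 : ∀ t : ℝ, HasDerivAt (fun t : ℝ => (v : ℝ) + v * t * (v * t)) (2 * v ^ 2 * t) t :=
    fun t => by
      convert! ((e2 t).mul (e2 t)).const_add (v:ℝ) using 1; ring
  have e4 : ∀ t : ℝ, HasDerivAt (fun t : ℝ => 2 * (v : ℝ) ^ 2 * t + (v + v * t * (v * t)) * (v * t))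
      (3 * v ^ 2 + 3 * v ^ 3 * t ^ 2) t := fun t => by
      convert! ((hasDerivAt_id t).const_mul (2 * (v:ℝ) ^ 2)).add ((e3 t).mul (e2 t)) using 1
      simp; ring
  rw [mgf_id_gaussianReal] at h
  simp only [iteratedDeriv_succ, iteratedDeriv_zero] at h
  rw [d1, dm _ _ e2, dm _ _ e3, dm _ _ e4] at h
  simpa using h.symm

lemma gaussianReal_second_moment (v : ℝ≥0) : ∫ x, x ^ 2 ∂(gaussianReal 0 v) = v := by
  have h := variance_fun_id_gaussianReal (μ := 0) (v := v)
  rw [variance_eq_integral (by fun_prop)] at h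
  simpa using h

/-- The map that assembles a complex number from its real and imaginary parts. -/
lemma measurableEmbedding_complex_mk :
    MeasurableEmbedding (fun z : ℝ × ℝ => (⟨z.1, z.2⟩ : ℂ)) :=
  Complex.measurableEquivRealProd.symm.measurableEmbedding

instance (v : ℝ≥0) : IsProbabilityMeasure (circGaussian v) :=
  Measure.isProbabilityMeasure_map measurableEmbedding_complex_mk.measurable.aemeasurable

lemma integral_circGaussian {E : Type*} [NormedAddCommGroup E] [NormedSpace ℝ E] (v : ℝ≥0)
    (f : ℂ → E) : ∫ z, f z ∂(circGaussian v) =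
      ∫ z : ℝ × ℝ, f ⟨z.1, z.2⟩ ∂((gaussianReal 0 (v / 2)).prod (gaussianReal 0 (v / 2))) :=
  measurableEmbedding_complex_mk.integral_map f

lemma hasAllMoments_circGaussian (v : ℝ≥0) : HasAllMoments (fun z => z) (circGaussian v) := by
  intro p hp
  have hg := memLp_id_gaussianReal' (μ := 0) (v := v / 2) p hp
  have h1 := (hg.comp_fst (gaussianReal 0 (v / 2))).ofReal (K := ℂ)
  have h2 := ((hg.comp_snd (gaussianReal 0 (v / 2))).ofReal (K := ℂ)).const_mul Complex.I
  refine (measurableEmbedding_complex_mk.memLp_map_measure_iff).2 ?_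
  refine (h1.add h2).congr_norm ?_ ?_
  · exact measurableEmbedding_complex_mk.measurable.aestronglyMeasurable
  · refine Filter.Eventually.of_forall fun z => ?_
    simp only [Pi.add_apply, id, Function.comp]
    congr 1
    apply Complex.ext <;> simp

/-- Invariance under a quarter turn; it already forces all unbalanced moments to vanish. -/
lemma circGaussian_map_I_mul (v : ℝ≥0) :
    MeasurePreserving (fun z : ℂ => Complex.I * z) (circGaussian v) (circGaussian v) := by
  refine ⟨by fun_prop, ?_⟩
  set γ := gaussianReal 0 (v / 2)
  have hneg : MeasurePreserving (fun x : ℝ => -x) γ γ :=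
    ⟨by fun_prop, by simp [γ, gaussianReal_map_neg]⟩
  have hrot : MeasurePreserving (fun z : ℝ × ℝ => (-z.2, z.1)) (γ.prod γ) (γ.prod γ) :=
    (hneg.prod (MeasurePreserving.id γ)).comp Measure.measurePreserving_swap
  unfold circGaussian
  rw [Measure.map_map (by fun_prop) measurableEmbedding_complex_mk.measurable]
  conv_rhs => rw [← hrot.map_eq,
    Measure.map_map measurableEmbedding_complex_mk.measurable hrot.measurable]
  congr 1
  funext z
  apply Complex.ext <;> simp

lemma integral_circGaussian_mul_star (v : ℝ≥0) :
    ∫ z, z * star z ∂(circGaussian v) = ((v : ℝ) : ℂ) := by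
  have hg := memLp_id_gaussianReal' (μ := 0) (v := v / 2) 2 (by simp)
  have h2 : Integrable (fun x : ℝ => x ^ 2) (gaussianReal 0 (v / 2)) := hg.integrable_sq
  have : ∀ z : ℂ, z * star z = ((z.re ^ 2 + z.im ^ 2 : ℝ) : ℂ) := fun z => by
    rw [Complex.star_def, Complex.mul_conj, Complex.normSq_apply]; ring_nf
  simp_rw [this]
  rw [integral_complex_ofReal, integral_circGaussian]
  rw [integral_add (h2.comp_fst _) (h2.comp_snd _), integral_fun_fst (fun x : ℝ => x ^ 2),
    integral_fun_snd (fun x : ℝ => x ^ 2), gaussianReal_second_moment]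
  simp

lemma integral_circGaussian_mul_star_sq (v : ℝ≥0) :
    ∫ z, z * star z * (z * star z) ∂(circGaussian v) = 2 * ((v : ℝ) : ℂ) ^ 2 := by
  have hg := memLp_id_gaussianReal' (μ := 0) (v := v / 2) 2 (by simp)
  have hg4 := memLp_id_gaussianReal' (μ := 0) (v := v / 2) 4 (by simp)
  have h2 : Integrable (fun x : ℝ => x ^ 2) (gaussianReal 0 (v / 2)) := hg.integrable_sq
  have h4 : Integrable (fun x : ℝ => x ^ 4) (gaussianReal 0 (v / 2)) := by
    have := hg4.integrable_norm_pow (p := 4) (by norm_num)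
    refine this.congr (Filter.Eventually.of_forall fun x => ?_)
    simp [Even.pow_abs (show Even 4 by decide)]
  have : ∀ z : ℂ, z * star z * (z * star z) =
      ((z.re ^ 4 + 2 * (z.re ^ 2 * z.im ^ 2) + z.im ^ 4 : ℝ) : ℂ) := fun z => by
    rw [Complex.star_def, Complex.mul_conj, Complex.normSq_apply]; push_cast; ring
  simp_rw [this]
  have h22 := (h2.mul_prod h2).const_mul 2
  have h422 : Integrable (fun x : ℝ × ℝ => x.1 ^ 4 + 2 * (x.1 ^ 2 * x.2 ^ 2))
      ((gaussianReal 0 (v / 2)).prod (gaussianReal 0 (v / 2))) := (h4.comp_fst _).add h22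
  rw [integral_complex_ofReal, integral_circGaussian, integral_add h422 (h4.comp_snd _),
    integral_add (h4.comp_fst _) h22, integral_fun_fst (fun x : ℝ => x ^ 4),
    integral_fun_snd (fun x : ℝ => x ^ 4), integral_const_mul,
    integral_prod_mul (fun x : ℝ => x ^ 2) (fun x : ℝ => x ^ 2), gaussianReal_second_moment,
    gaussianReal_fourth_moment]
  simp
  ring

lemma circGaussian_map_mul (s : ℝ) (v : ℝ≥0) (hv : s ^ 2 = v) :
    (circGaussian 1).map (fun z => (s : ℂ) * z) = circGaussian v := by
  have hs : MeasurePreserving (fun x : ℝ => s * x) (gaussianReal 0 (1 / 2))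
      (gaussianReal 0 (v / 2)) := by
    refine ⟨by fun_prop, ?_⟩
    rw [gaussianReal_map_const_mul]
    congr 1
    · simp
    · ext; simp [hv]; ring
  have h2 := hs.prod hs
  unfold circGaussian
  rw [Measure.map_map (by fun_prop) measurableEmbedding_complex_mk.measurable, ← h2.map_eq,
    Measure.map_map measurableEmbedding_complex_mk.measurable h2.measurable]
  congr 1
  funext z
  apply Complex.ext <;> simp

/-! ### Moments of independent circular Gaussians -/

/-- The joint law of independent `CN(0, v i)` variables. -/
noncomputable abbrev circGaussianPi {ι : Type*} [Fintype ι] (v : ι → ℝ≥0) : Measure (ι → ℂ) :=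
  Measure.pi fun i => circGaussian (v i)

section Moments

variable {ι : Type*} [Fintype ι] (v : ι → ℝ≥0)

lemma hasAllMoments_circGaussianPi_eval (i : ι) :
    HasAllMoments (fun z : ι → ℂ => z i) (circGaussianPi v) :=
  (hasAllMoments_circGaussian (v i)).comp_measurePreserving
    (measurePreserving_eval (fun i => circGaussian (v i)) i)

lemma integral_circGaussianPi_eval (i : ι) (f : ℂ → ℂ) (hf : Continuous f) :
    ∫ z, f (z i) ∂(circGaussianPi v) = ∫ z, f z ∂(circGaussian (v i)) := by
  have hT := measurePreserving_eval (fun i => circGaussian (v i)) i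
  rw [← hT.map_eq, integral_map hT.measurable.aemeasurable hf.aestronglyMeasurable]

variable [DecidableEq ι]

/-- A quarter turn of the coordinate `k`, the other coordinates being kept. -/
noncomputable def quarterTurn (k : ι) (z : ι → ℂ) : ι → ℂ :=
  fun i => if i = k then Complex.I * z i else z i

lemma measurePreserving_quarterTurn (k : ι) :
    MeasurePreserving (quarterTurn k) (circGaussianPi v) (circGaussianPi v) := by
  refine measurePreserving_pi (f := fun i z => if i = k then Complex.I * z else z) _ _ fun i => ?_
  by_cases h : i = k
  · simpa [h] using circGaussian_map_I_mul (v k)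
  · simpa [h] using! MeasurePreserving.id (circGaussian (v i))

/-- A function that a quarter turn of one coordinate multiplies by `c ≠ 1` has mean zero. -/
lemma integral_eq_zero_of_quarterTurn {f : (ι → ℂ) → ℂ} (hf : Continuous f) (k : ι) (c : ℂ)
    (hc : c ≠ 1) (h : ∀ z, f (quarterTurn k z) = c * f z) :
    ∫ z, f z ∂(circGaussianPi v) = 0 := by
  have hT := measurePreserving_quarterTurn v k
  have h1 : ∫ z, f z ∂(circGaussianPi v) = ∫ z, f (quarterTurn k z) ∂(circGaussianPi v) := by
    conv_lhs => rw [← hT.map_eq]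
    exact integral_map hT.measurable.aemeasurable hf.aestronglyMeasurable
  simp_rw [h] at h1
  rw [integral_const_mul] at h1
  have : (1 - c) * ∫ z, f z ∂(circGaussianPi v) = 0 := by linear_combination h1
  rcases mul_eq_zero.1 this with h | h
  · exact absurd (sub_eq_zero.1 h).symm hc
  · exact h

lemma integral_circGaussianPi_coord (i : ι) : ∫ z, z i ∂(circGaussianPi v) = 0 := by
  refine integral_eq_zero_of_quarterTurn v (by fun_prop) i Complex.I (by simp [Complex.ext_iff]) ?_
  intro z; simp [quarterTurn]

lemma integral_circGaussianPi_star (i : ι) : ∫ z, star (z i) ∂(circGaussianPi v) = 0 := by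
  refine integral_eq_zero_of_quarterTurn v (by fun_prop) i (-Complex.I)
    (by simp [Complex.ext_iff]) ?_
  intro z; simp [quarterTurn]

lemma integral_circGaussianPi_mul_star (i j : ι) :
    ∫ z, z i * star (z j) ∂(circGaussianPi v) = if i = j then ((v i : ℝ) : ℂ) else 0 := by
  split_ifs with h
  · subst h
    rw [integral_circGaussianPi_eval v i (fun z => z * star z) (by fun_prop),
      integral_circGaussian_mul_star]
  · refine integral_eq_zero_of_quarterTurn v (by fun_prop) i Complex.I
      (by simp [Complex.ext_iff]) ?_
    intro z; simp [quarterTurn, Ne.symm h]; ring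

lemma integral_circGaussianPi_third (i j k : ι) :
    ∫ z, z i * (z j * star (z k)) ∂(circGaussianPi v) = 0 := by
  by_cases hij : i = j
  · subst hij
    by_cases hik : i = k
    · subst hik
      refine integral_eq_zero_of_quarterTurn v (by fun_prop) i Complex.I
        (by simp [Complex.ext_iff]) ?_
      intro z; simp [quarterTurn]; ring_nf; simp
    · refine integral_eq_zero_of_quarterTurn v (by fun_prop) i (-1) (by norm_num) ?_
      intro z; simp [quarterTurn, Ne.symm hik]; ring_nf; simp [Complex.I_sq]
  · by_cases hik : i = k
    · subst hik
      refine integral_eq_zero_of_quarterTurn v (by fun_prop) j Complex.I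
        (by simp [Complex.ext_iff]) ?_
      intro z; simp [quarterTurn, hij]; ring
    · refine integral_eq_zero_of_quarterTurn v (by fun_prop) i Complex.I
        (by simp [Complex.ext_iff]) ?_
      intro z; simp [quarterTurn, Ne.symm hij, Ne.symm hik]; ring

lemma integral_circGaussianPi_third_star (i j k : ι) :
    ∫ z, star (z i) * (z j * star (z k)) ∂(circGaussianPi v) = 0 := by
  have h := congrArg star (integral_circGaussianPi_third v i k j)
  rw [Complex.star_def, ← integral_conj] at h
  simpa [mul_comm] using h

/-- Wick's formula for the balanced fourth moments. -/
lemma integral_circGaussianPi_fourth (i j k l : ι) :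
    ∫ z, z i * star (z j) * (z k * star (z l)) ∂(circGaussianPi v) =
      (if i = j ∧ k = l then ((v i : ℝ) : ℂ) * ((v k : ℝ) : ℂ) else 0) +
      (if i = l ∧ k = j then ((v i : ℝ) : ℂ) * ((v k : ℝ) : ℂ) else 0) := by
  have hI : Complex.I ≠ 1 := by simp [Complex.ext_iff]
  have hI' : (-1 : ℂ) ≠ 1 := by norm_num
  -- In each unbalanced case below some coordinate occurs unequally often with and without a
  -- conjugate; its quarter turn multiplies the integrand by `I` or, if it occurs twice, by `-1`.
  have two : ∀ i k : ι, i ≠ k → ∫ z, z i * star (z i) * (z k * star (z k)) ∂(circGaussianPi v) =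
      ((v i : ℝ) : ℂ) * ((v k : ℝ) : ℂ) := by
    intro i k hik
    have hind : iIndepFun (fun i (z : ι → ℂ) => z i * star (z i)) (circGaussianPi v) :=
      iIndepFun_pi (X := fun _ (z : ℂ) => z * star z)
        (fun i => (by fun_prop : Continuous fun z : ℂ => z * star z).aemeasurable)
    rw [(hind.indepFun hik).integral_fun_mul_eq_mul_integral
      (Continuous.aestronglyMeasurable (by fun_prop))
      (Continuous.aestronglyMeasurable (by fun_prop)),
      integral_circGaussianPi_mul_star, integral_circGaussianPi_mul_star]
    simp
  by_cases hij : i = j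
  · subst hij
    by_cases hkl : k = l
    · subst hkl
      by_cases hik : i = k
      · subst hik
        rw [integral_circGaussianPi_eval v i (fun z => z * star z * (z * star z)) (by fun_prop),
          integral_circGaussian_mul_star_sq]
        simp; ring
      · rw [two i k hik]; simp [hik]
    · rw [integral_eq_zero_of_quarterTurn v (by fun_prop) k Complex.I hI]
      · simp [hkl]
        intro h1 h2; exact absurd (h2.trans h1) hkl
      · intro z
        by_cases hik : i = k
        · subst hik
          simp [quarterTurn, Ne.symm hkl]; ring_nf; simp
        · simp [quarterTurn, hik, Ne.symm hkl]; ring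
  · by_cases hil : i = l
    · subst hil
      by_cases hkj : k = j
      · subst hkj
        have : ∀ z : ι → ℂ, z i * star (z k) * (z k * star (z i)) =
          z i * star (z i) * (z k * star (z k)) := fun z => by ring
        simp_rw [this]
        rw [two i k hij]; simp [hij]
      · by_cases hik : i = k
        · subst hik
          rw [integral_eq_zero_of_quarterTurn v (by fun_prop) i Complex.I hI]
          · simp [hij]
          · intro z
            simp [quarterTurn, Ne.symm hij]; ring_nf; simp
        · rw [integral_eq_zero_of_quarterTurn v (by fun_prop) k Complex.I hI]
          · simp [hij, hkj]
          · intro z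
            simp [quarterTurn, hik, Ne.symm hkj]; ring
    · by_cases hik : i = k
      · subst hik
        rw [integral_eq_zero_of_quarterTurn v (by fun_prop) i (-1) hI']
        · simp [hij, hil]
        · intro z
          simp [quarterTurn, Ne.symm hij, Ne.symm hil]; ring_nf; simp [Complex.I_sq]
      · rw [integral_eq_zero_of_quarterTurn v (by fun_prop) i Complex.I hI]
        · simp [hij, hil]
        · intro z
          simp [quarterTurn, Ne.symm hij, Ne.symm hil, Ne.symm hik]; ring

end Moments

/-! ### Phase drift correlations -/

lemma integral_cexp_gaussianReal (v : ℝ≥0) :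
    ∫ x : ℝ, Complex.exp (Complex.I * (x : ℂ)) ∂(gaussianReal 0 v) =
      ((Real.exp (-((v : ℝ) / 2)) : ℝ) : ℂ) := by
  have h := charFun_gaussianReal (μ := 0) (v := v) 1
  rw [charFun_apply_real] at h
  push_cast
  convert h using 2
  · funext x; congr 1; push_cast; ring
  · push_cast; ring_nf

/-- The phase factor `exp(i φ_n(s+1))` as a function of the phase drifts of all antennas. -/
noncomputable def phasor {N T : ℕ} (n : Fin N) (s : Fin T) (φ : Fin N → Fin T → ℝ) : ℂ :=
  Complex.exp (Complex.I * (φ n s : ℂ))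

@[fun_prop]
lemma continuous_phasor {N T : ℕ} (n : Fin N) (s : Fin T) : Continuous (phasor n s) := by
  unfold phasor; fun_prop

lemma phasor_mul_star {N T : ℕ} (n : Fin N) (s : Fin T) (φ : Fin N → Fin T → ℝ) :
    phasor n s φ * star (phasor n s φ) = 1 := by
  rw [phasor, Complex.star_def, ← Complex.exp_conj, ← Complex.exp_add]
  simp

lemma norm_phasor {N T : ℕ} (n : Fin N) (s : Fin T) (φ : Fin N → Fin T → ℝ) :
    ‖phasor n s φ‖ = 1 := by
  rw [phasor, mul_comm]; exact Complex.norm_exp_ofReal_mul_I _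

/-- The correlation `exp(-δ|a-b|/2)` of two phase factors of one antenna. -/
noncomputable def phaseCorr (δ : ℝ≥0) (a b : ℕ) : ℂ :=
  ((Real.exp (-((δ : ℝ) / 2) * |(a : ℝ) - (b : ℝ)|) : ℝ) : ℂ)

lemma phaseCorr_comm (δ : ℝ≥0) (a b : ℕ) : phaseCorr δ a b = phaseCorr δ b a := by
  rw [phaseCorr, phaseCorr, abs_sub_comm]

lemma phaseCorr_self (δ : ℝ≥0) (a : ℕ) : phaseCorr δ a a = 1 := by simp [phaseCorr]

lemma star_phaseCorr (δ : ℝ≥0) (a b : ℕ) : star (phaseCorr δ a b) = phaseCorr δ a b :=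
  Complex.conj_ofReal _

section Phase

variable {L K N B T : ℕ} {Ω : Type*} [MeasurableSpace Ω] {P : Measure Ω}
    [IsProbabilityMeasure P] {S : UplinkParams L K B} {M : UplinkSignals L K N Ω}

/-- The correlation of two phase factors of one antenna, by adding one independent Gaussian
increment at a time. -/
lemma integral_phase_increment (hM : IsHardwareUplink P T S M) (j : Fin L) (n : Fin N) (s : ℕ) :
    ∀ d : ℕ, s + d + 1 ≤ T →
      ∫ ω, Complex.exp (Complex.I * (M.phi j n (s + d + 1) ω : ℂ)) *
        star (Complex.exp (Complex.I * (M.phi j n (s + 1) ω : ℂ))) ∂P =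
      ((Real.exp (-((S.delta : ℝ) / 2) * d) : ℝ) : ℂ) := by
  intro d
  induction d with
  | zero =>
    intro _
    have : ∀ x : ℝ, Complex.exp (Complex.I * (x : ℂ)) *
        star (Complex.exp (Complex.I * (x : ℂ))) = 1 := fun x => by
      rw [Complex.star_def, ← Complex.exp_conj, ← Complex.exp_add]; simp
    simp only [add_zero, this]
    simp
  | succ d ih =>
    intro hd
    have ih := ih (by omega)
    have hind := hM.indep_innovation j n (s + d + 1) (by omega) hd
    have hlaw := hM.law_phi j n (s + d + 1) (by omega) hd
    have hc1 : Continuous fun x : ℝ => Complex.exp (Complex.I * (x : ℂ)) := by fun_prop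
    have hc2 : Continuous fun v : Fin (s + d + 1) → ℝ =>
        Complex.exp (Complex.I * (v ⟨s + d, by omega⟩ : ℂ)) *
          star (Complex.exp (Complex.I * (v ⟨s, by omega⟩ : ℂ))) := by fun_prop
    have hphase : Measurable (M.phase (s + d + 1) j n) :=
      measurable_pi_lambda _ fun _ => hM.measurable_phi j n _
    have h := (hind.comp hc1.measurable hc2.measurable).integral_fun_mul_eq_mul_integral
      (hc1.measurable.comp ((hM.measurable_phi _ _ _).sub
        (hM.measurable_phi _ _ _))).aestronglyMeasurable
      (hc2.measurable.comp hphase).aestronglyMeasurable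
    have h1 := hlaw.integral_comp (f := fun x : ℝ => Complex.exp (Complex.I * (x : ℂ)))
      hc1.aestronglyMeasurable
    rw [integral_cexp_gaussianReal] at h1
    rw [h1] at h
    simp only [Function.comp_apply, UplinkSignals.phase] at h
    rw [ih] at h
    rw [show s + (d + 1) + 1 = s + d + 1 + 1 by ring]
    convert h using 1
    · refine integral_congr_ae (Filter.Eventually.of_forall fun ω => ?_)
      simp only
      rw [← mul_assoc, ← Complex.exp_add]
      congr 2
      push_cast; ring
    · rw [← Complex.ofReal_mul, ← Real.exp_add]
      congr 2
      push_cast; ring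

/-- The law of the phase drifts of all antennas. -/
noncomputable def UplinkSignals.phaseLaw (M : UplinkSignals L K N Ω) (P : Measure Ω) (T : ℕ)
    (j : Fin L) : Measure (Fin N → Fin T → ℝ) :=
  P.map fun ω n => M.phase T j n ω

lemma measurable_phases (hM : IsHardwareUplink P T S M) (j : Fin L) :
    Measurable fun ω (n : Fin N) => M.phase T j n ω :=
  measurable_pi_lambda _ fun n => measurable_pi_lambda _ fun _ => hM.measurable_phi j n _

lemma integral_phasor (hM : IsHardwareUplink P T S M) (j : Fin L) (n : Fin N) (a b : Fin T) :
    ∫ φ, phasor n a φ * star (phasor n b φ) ∂(M.phaseLaw P T j) = phaseCorr S.delta a b := by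
  have key : ∀ a b : Fin T, b ≤ a → ∫ φ, phasor n a φ * star (phasor n b φ) ∂(M.phaseLaw P T j) =
      phaseCorr S.delta a b := by
    intro a b hab
    rw [UplinkSignals.phaseLaw, integral_map (measurable_phases hM j).aemeasurable
      (Continuous.aestronglyMeasurable (by fun_prop))]
    have hab' : (b : ℕ) ≤ a := hab
    have h := integral_phase_increment hM j n b (a - b) (by omega)
    rw [show (b : ℕ) + (a - b) + 1 = a + 1 by omega, Nat.cast_sub hab'] at h
    rw [phaseCorr, abs_of_nonneg (by simpa using hab')]
    exact h
  rcases le_total b a with h | h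
  · exact key a b h
  · have h2 := congrArg star (key b a h)
    rw [Complex.star_def, ← integral_conj, ← Complex.star_def, star_phaseCorr, phaseCorr_comm] at h2
    rw [← h2]
    refine integral_congr_ae (Filter.Eventually.of_forall fun ω => ?_)
    simp [mul_comm]

/-- The joint moment of four phase factors that occurs in the second moment of the filter output.
For one antenna the two factors at `t` cancel; two antennas have independent phases. -/
lemma integral_phasor_four (hM : IsHardwareUplink P T S M) (j : Fin L) (n n' : Fin N)
    (a b t : Fin T) :
    ∫ φ, phasor n a φ * star (phasor n' b φ) * (phasor n' t φ * star (phasor n t φ))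
      ∂(M.phaseLaw P T j) =
      if n = n' then phaseCorr S.delta a b else phaseCorr S.delta t a * phaseCorr S.delta t b := by
  split_ifs with h
  · subst h
    simp only [phasor_mul_star, mul_one]
    exact integral_phasor hM j n a b
  · have hc : ∀ (a b : Fin T), Continuous fun v : Fin T → ℝ =>
        Complex.exp (Complex.I * (v a : ℂ)) * star (Complex.exp (Complex.I * (v b : ℂ))) :=
      fun a b => by fun_prop
    have hm : ∀ n, Measurable (M.phase T j n) := fun n =>
      measurable_pi_lambda _ fun _ => hM.measurable_phi j n _
    have hind := (((hM.indep_phi j).indepFun h).comp (hc a t).measurable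
      (hc t b).measurable).integral_fun_mul_eq_mul_integral
      ((hc a t).measurable.comp (hm n)).aestronglyMeasurable
      ((hc t b).measurable.comp (hm n')).aestronglyMeasurable
    have e : ∀ (n : Fin N) (a b : Fin T), ∫ ω, ((fun v : Fin T → ℝ =>
        Complex.exp (Complex.I * (v a : ℂ)) * star (Complex.exp (Complex.I * (v b : ℂ)))) ∘
          M.phase T j n) ω ∂P = phaseCorr S.delta a b := by
      intro n a b
      rw [← integral_phasor hM j n a b, UplinkSignals.phaseLaw,
        integral_map (measurable_phases hM j).aemeasurable
          (Continuous.aestronglyMeasurable (by fun_prop))]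
      rfl
    rw [e, e, phaseCorr_comm _ a t] at hind
    rw [← hind, UplinkSignals.phaseLaw, integral_map (measurable_phases hM j).aemeasurable]
    · refine integral_congr_ae (Filter.Eventually.of_forall fun ω => ?_)
      simp only [Function.comp, phasor]
      ring
    · exact Continuous.aestronglyMeasurable (by fun_prop)

end Phase

/-! ### Second moments of sums of product-form variables -/

section ProductForm

variable {α β γ δ : Type*} [MeasurableSpace α] [MeasurableSpace β] [MeasurableSpace γ]
  [MeasurableSpace δ] {μ : Measure α} {ν : Measure β} {ρ : Measure γ} {τ : Measure δ}
  [IsProbabilityMeasure μ] [IsProbabilityMeasure ν] [IsProbabilityMeasure ρ]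
  [IsProbabilityMeasure τ]

lemma integral_prod_four (f : α → ℂ) (g : β → ℂ) (k : γ → ℂ) (m : δ → ℂ) :
    ∫ q : (α × (β × γ)) × δ, f q.1.1 * (g q.1.2.1 * k q.1.2.2) * m q.2
      ∂((μ.prod (ν.prod ρ)).prod τ) =
    (∫ a, f a ∂μ) * ((∫ b, g b ∂ν) * (∫ c, k c ∂ρ)) * ∫ d, m d ∂τ := by
  rw [← integral_prod_mul (μ := ν) (ν := ρ) g k,
    ← integral_prod_mul (μ := μ) (ν := ν.prod ρ) f (fun z => g z.1 * k z.2),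
    ← integral_prod_mul (μ := μ.prod (ν.prod ρ)) (ν := τ)
      (fun z => f z.1 * (g z.2.1 * k z.2.2)) m]

lemma HasAllMoments.prod_four {f : α → ℂ} {g : β → ℂ} {k : γ → ℂ} {m : δ → ℂ}
    (hf : HasAllMoments f μ) (hg : HasAllMoments g ν) (hk : HasAllMoments k ρ)
    (hm : HasAllMoments m τ) :
    HasAllMoments (fun q : (α × (β × γ)) × δ => f q.1.1 * (g q.1.2.1 * k q.1.2.2) * m q.2)
      ((μ.prod (ν.prod ρ)).prod τ) := by
  have h1 : MeasurePreserving (Prod.fst : (α × (β × γ)) × δ → _) ((μ.prod (ν.prod ρ)).prod τ)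
    (μ.prod (ν.prod ρ)) := measurePreserving_fst
  have h2 : MeasurePreserving (Prod.snd : (α × (β × γ)) × δ → _) ((μ.prod (ν.prod ρ)).prod τ)
    τ := measurePreserving_snd
  have h3 : MeasurePreserving (Prod.fst : α × (β × γ) → _) (μ.prod (ν.prod ρ))
    μ := measurePreserving_fst
  have h4 : MeasurePreserving (Prod.snd : α × (β × γ) → _) (μ.prod (ν.prod ρ))
    (ν.prod ρ) := measurePreserving_snd
  have h5 : MeasurePreserving (Prod.fst : β × γ → _) (ν.prod ρ) ν := measurePreserving_fst
  have h6 : MeasurePreserving (Prod.snd : β × γ → _) (ν.prod ρ) ρ := measurePreserving_snd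
  exact ((hf.comp_measurePreserving (h3.comp h1)).mul
    ((hg.comp_measurePreserving (h5.comp (h4.comp h1))).mul
      (hk.comp_measurePreserving (h6.comp (h4.comp h1))))).mul (hm.comp_measurePreserving h2)

/-- The mixed second moment of two signals, each the sum of a faded signal `s * e`, a distortion
`r * z` and a noise `w`, weighted by an independent-factor weight `gC * gΦ * gZ`. The cross terms
vanish because noise and distortion have mean zero. -/
lemma integral_signal_mul_star {s s' r r' gC : α → ℂ} {e e' gΦ : β → ℂ} {w w' : γ → ℂ}
    {z z' gZ : δ → ℂ}
    (hs : HasAllMoments s μ) (hs' : HasAllMoments s' μ)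
    (hr : HasAllMoments r μ) (hr' : HasAllMoments r' μ) (hgC : HasAllMoments gC μ)
    (he : HasAllMoments e ν) (he' : HasAllMoments e' ν) (hgΦ : HasAllMoments gΦ ν)
    (hw : HasAllMoments w ρ) (hw' : HasAllMoments w' ρ)
    (hz : HasAllMoments z τ) (hz' : HasAllMoments z' τ) (hgZ : HasAllMoments gZ τ)
    (hw0 : ∫ c, w c ∂ρ = 0) (hw0' : ∫ c, star (w' c) ∂ρ = 0)
    (hz0 : ∫ d, z d * gZ d ∂τ = 0) (hz0' : ∫ d, star (z' d) * gZ d ∂τ = 0) :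
    ∫ q : (α × (β × γ)) × δ, (e q.1.2.1 * s q.1.1 + r q.1.1 * z q.2 + w q.1.2.2) *
        star (e' q.1.2.1 * s' q.1.1 + r' q.1.1 * z' q.2 + w' q.1.2.2) *
        (gC q.1.1 * gΦ q.1.2.1 * gZ q.2) ∂((μ.prod (ν.prod ρ)).prod τ) =
      (∫ a, s a * star (s' a) * gC a ∂μ) * (∫ b, e b * star (e' b) * gΦ b ∂ν) *
        (∫ d, gZ d ∂τ) +
      (∫ a, r a * star (r' a) * gC a ∂μ) * (∫ b, gΦ b ∂ν) *
        (∫ d, z d * star (z' d) * gZ d ∂τ) +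
      (∫ a, gC a ∂μ) * (∫ b, gΦ b ∂ν) * (∫ c, w c * star (w' c) ∂ρ) * (∫ d, gZ d ∂τ) := by
  -- Both signals are sums of three products: faded signal (0), distortion (1), noise (2).
  let F : Fin 3 → α → ℂ := ![s, r, fun _ => 1]
  let F' : Fin 3 → α → ℂ := ![s', r', fun _ => 1]
  let G : Fin 3 → β → ℂ := ![e, fun _ => 1, fun _ => 1]
  let G' : Fin 3 → β → ℂ := ![e', fun _ => 1, fun _ => 1]
  let W : Fin 3 → γ → ℂ := ![fun _ => 1, fun _ => 1, w]
  let W' : Fin 3 → γ → ℂ := ![fun _ => 1, fun _ => 1, w']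
  let Z : Fin 3 → δ → ℂ := ![fun _ => 1, z, fun _ => 1]
  let Z' : Fin 3 → δ → ℂ := ![fun _ => 1, z', fun _ => 1]
  have hF : ∀ i, HasAllMoments (F i) μ := by
    intro i; fin_cases i; exacts [hs, hr, HasAllMoments.const 1]
  have hF' : ∀ i, HasAllMoments (F' i) μ := by
    intro i; fin_cases i; exacts [hs', hr', HasAllMoments.const 1]
  have hG : ∀ i, HasAllMoments (G i) ν := by
    intro i; fin_cases i; exacts [he, HasAllMoments.const 1, HasAllMoments.const 1]
  have hG' : ∀ i, HasAllMoments (G' i) ν := by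
    intro i; fin_cases i; exacts [he', HasAllMoments.const 1, HasAllMoments.const 1]
  have hW : ∀ i, HasAllMoments (W i) ρ := by
    intro i; fin_cases i; exacts [HasAllMoments.const 1, HasAllMoments.const 1, hw]
  have hW' : ∀ i, HasAllMoments (W' i) ρ := by
    intro i; fin_cases i; exacts [HasAllMoments.const 1, HasAllMoments.const 1, hw']
  have hZ : ∀ i, HasAllMoments (Z i) τ := by
    intro i; fin_cases i; exacts [HasAllMoments.const 1, hz, HasAllMoments.const 1]
  have hZ' : ∀ i, HasAllMoments (Z' i) τ := by
    intro i; fin_cases i; exacts [HasAllMoments.const 1, hz', HasAllMoments.const 1]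
  have expand : ∀ q : (α × (β × γ)) × δ,
      (e q.1.2.1 * s q.1.1 + r q.1.1 * z q.2 + w q.1.2.2) *
        star (e' q.1.2.1 * s' q.1.1 + r' q.1.1 * z' q.2 + w' q.1.2.2) *
        (gC q.1.1 * gΦ q.1.2.1 * gZ q.2) =
      ∑ i, ∑ k, (fun a => F i a * star (F' k a) * gC a) q.1.1 *
        ((fun b => G i b * star (G' k b) * gΦ b) q.1.2.1 *
          (fun c => W i c * star (W' k c)) q.1.2.2) *
        (fun d => Z i d * star (Z' k d) * gZ d) q.2 := by
    intro q
    simp [Fin.sum_univ_three, F, F', G, G', W, W', Z, Z']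
    ring
  have hint : ∀ i k, Integrable (fun q : (α × (β × γ)) × δ =>
      (fun a => F i a * star (F' k a) * gC a) q.1.1 *
        ((fun b => G i b * star (G' k b) * gΦ b) q.1.2.1 *
          (fun c => W i c * star (W' k c)) q.1.2.2) *
        (fun d => Z i d * star (Z' k d) * gZ d) q.2) ((μ.prod (ν.prod ρ)).prod τ) :=
    fun i k => (HasAllMoments.prod_four (((hF i).mul (hF' k).star).mul hgC)
      (((hG i).mul (hG' k).star).mul hgΦ) ((hW i).mul (hW' k).star)
      (((hZ i).mul (hZ' k).star).mul hgZ)).integrable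
  simp_rw [expand]
  rw [integral_finsetSum _ fun i _ => integrable_finsetSum _ fun k _ => hint i k]
  refine (Finset.sum_congr rfl fun i _ => (integral_finsetSum _ fun k _ => hint i k).trans
    (Finset.sum_congr rfl fun k _ => integral_prod_four (fun a => F i a * star (F' k a) * gC a)
      (fun b => G i b * star (G' k b) * gΦ b) (fun c => W i c * star (W' k c))
      (fun d => Z i d * star (Z' k d) * gZ d))).trans ?_
  simp only [RCLike.star_def] at hw0' hz0'
  simp [-mul_eq_mul_right_iff, Fin.sum_univ_three, F, F', G, G', W, W', Z, Z', hw0, hz0, hw0', hz0']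
  ring

end ProductForm

/-! ### The joint law of channels, phases, noise and distortion -/

/-- The values of channels, phase drifts, thermal noise and (normalised or actual) distortion noise
at one base station in one block, in this order. -/
abbrev BlockSpace (L K N T : ℕ) : Type :=
  ((Fin L → Fin K → Fin N → ℂ) × ((Fin N → Fin T → ℝ) × (Fin T × Fin N → ℂ))) ×
    (Fin T × Fin N → ℂ)

/-- The distortion variance at antenna `n` for transmit powers `p` and channels `c`. -/
noncomputable def distVar {L K N : ℕ} (κ : ℝ) (p : Fin L → Fin K → ℝ)
    (c : Fin L → Fin K → Fin N → ℂ) (n : Fin N) : ℝ :=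
  κ ^ 2 * ∑ l, ∑ k, p l k * ‖c l k n‖ ^ 2

lemma distVar_nonneg {L K N : ℕ} (κ : ℝ) {p : Fin L → Fin K → ℝ} (hp : ∀ l k, 0 ≤ p l k)
    (c : Fin L → Fin K → Fin N → ℂ) (n : Fin N) : 0 ≤ distVar κ p c n :=
  mul_nonneg (sq_nonneg _) (Finset.sum_nonneg fun l _ => Finset.sum_nonneg fun k _ =>
    mul_nonneg (hp l k) (sq_nonneg _))

@[fun_prop]
lemma continuous_distVar {L K N : ℕ} (κ : ℝ) (p : Fin L → Fin K → ℝ) (n : Fin N) :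
    Continuous fun c : Fin L → Fin K → Fin N → ℂ => distVar κ p c n := by
  unfold distVar; fun_prop

namespace UplinkSignals

variable {L K N B T : ℕ} {Ω : Type*} [MeasurableSpace Ω] (M : UplinkSignals L K N Ω)

/-- Channels, phase drifts and thermal noise of base station `j`. -/
def base (T : ℕ) (j : Fin L) (ω : Ω) :
    (Fin L → Fin K → Fin N → ℂ) × ((Fin N → Fin T → ℝ) × (Fin T × Fin N → ℂ)) :=
  (M.chan j ω, (fun n => M.phase T j n ω), M.noiseBlock T j ω)

/-- The symbol powers `E|x_{lk}(s+1)|²`. -/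
noncomputable def power (P : Measure Ω) (s : ℕ) (l : Fin L) (k : Fin K) : ℝ :=
  ∫ ω, ‖M.x l k (s + 1) ω‖ ^ 2 ∂P

/-- The reference measure, under which channels, phase drifts, thermal noise and a vector of
standard complex Gaussians are independent. -/
noncomputable def refMeasure (P : Measure Ω) (T : ℕ) (j : Fin L) :
    Measure (BlockSpace L K N T) :=
  ((P.map (M.chan j)).prod ((M.phaseLaw P T j).prod (P.map (M.noiseBlock T j)))).prod
    (circGaussianPi fun _ : Fin T × Fin N => 1)

/-- The distortion noise as standard complex Gaussians scaled by the standard deviations that the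
channels determine. -/
noncomputable def scaled (P : Measure Ω) (T : ℕ) (κ : ℝ)
    (q : BlockSpace L K N T) :
    BlockSpace L K N T :=
  (q.1, fun i => ((√(distVar κ (M.power P i.1) q.1.1 i.2) : ℝ) : ℂ) * q.2 i)

lemma power_nonneg (P : Measure Ω) (s : ℕ) (l : Fin L) (k : Fin K) : 0 ≤ M.power P s l k :=
  integral_nonneg fun _ => sq_nonneg _

lemma measurable_scaled (P : Measure Ω) (T : ℕ) (κ : ℝ) : Measurable (M.scaled P T κ) := by
  have h : ∀ p n, Measurable fun c : Fin L → Fin K → Fin N → ℂ => distVar κ p c n :=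
    fun p n => (continuous_distVar κ p n).measurable
  refine measurable_fst.prodMk (measurable_pi_lambda _ fun i => ?_)
  exact (Complex.measurable_ofReal.comp ((h _ _).comp
    (measurable_fst.comp measurable_fst)).sqrt).mul ((measurable_pi_apply i).comp measurable_snd)

end UplinkSignals

open UplinkSignals

section Transfer

variable {L K N B T : ℕ} {Ω : Type*} [MeasurableSpace Ω] {P : Measure Ω}
    [IsProbabilityMeasure P] {S : UplinkParams L K B} {M : UplinkSignals L K N Ω}

lemma measurable_chan (hM : IsHardwareUplink P T S M) (j : Fin L) : Measurable (M.chan j) :=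
  measurable_pi_lambda _ fun _ => measurable_pi_lambda _ fun _ => measurable_pi_lambda _ fun _ =>
    hM.measurable_h _ _ _ _

lemma measurable_noiseBlock (hM : IsHardwareUplink P T S M) (j : Fin L) :
    Measurable (M.noiseBlock T j) :=
  measurable_pi_lambda _ fun _ => hM.measurable_noise _ _ _

lemma measurable_upsBlock (hM : IsHardwareUplink P T S M) (j : Fin L) :
    Measurable (M.upsBlock T j) :=
  measurable_pi_lambda _ fun _ => hM.measurable_ups _ _ _

lemma measurable_base (hM : IsHardwareUplink P T S M) (j : Fin L) : Measurable (M.base T j) :=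
  (measurable_chan hM j).prodMk ((measurable_phases hM j).prodMk (measurable_noiseBlock hM j))

lemma isProbabilityMeasure_chan (hM : IsHardwareUplink P T S M) (j : Fin L) :
    IsProbabilityMeasure (P.map (M.chan j)) :=
  Measure.isProbabilityMeasure_map (measurable_chan hM j).aemeasurable

lemma isProbabilityMeasure_phaseLaw (hM : IsHardwareUplink P T S M) (j : Fin L) :
    IsProbabilityMeasure (M.phaseLaw P T j) :=
  Measure.isProbabilityMeasure_map (measurable_phases hM j).aemeasurable

lemma isProbabilityMeasure_noiseBlock (hM : IsHardwareUplink P T S M) (j : Fin L) :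
    IsProbabilityMeasure (P.map (M.noiseBlock T j)) :=
  Measure.isProbabilityMeasure_map (measurable_noiseBlock hM j).aemeasurable

lemma map_base (hM : IsHardwareUplink P T S M) (j : Fin L) :
    P.map (M.base T j) =
      (P.map (M.chan j)).prod ((M.phaseLaw P T j).prod (P.map (M.noiseBlock T j))) := by
  have h1 := (indepFun_iff_map_prod_eq_prod_map_map (measurable_chan hM j).aemeasurable
    ((measurable_phases hM j).prodMk (measurable_noiseBlock hM j)).aemeasurable).1
      (hM.indep_chan j)
  have h2 := (indepFun_iff_map_prod_eq_prod_map_map (measurable_phases hM j).aemeasurable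
    (measurable_noiseBlock hM j).aemeasurable).1 (hM.indep_phi_noise j)
  rw [h2] at h1
  exact h1

/-- The joint law is the image of the reference measure: conditionally on the channels, the
distortion noise is a vector of independent complex Gaussians with the prescribed variances. -/
lemma map_base_upsBlock (hM : IsHardwareUplink P T S M) (j : Fin L) :
    P.map (fun ω => (M.base T j ω, M.upsBlock T j ω)) =
      (M.refMeasure P T j).map (M.scaled P T S.kappa) := by
  have := isProbabilityMeasure_chan hM j
  have := isProbabilityMeasure_phaseLaw hM j
  have := isProbabilityMeasure_noiseBlock hM j
  have hbase : IsProbabilityMeasure (P.map (M.base T j)) :=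
    Measure.isProbabilityMeasure_map (measurable_base hM j).aemeasurable
  have hT := (M.measurable_scaled P T S.kappa)
  rw [← compProd_map_condDistrib (X := M.base T j) (measurable_upsBlock hM j).aemeasurable]
  ext s hs
  rw [Measure.map_apply hT hs, Measure.compProd_apply hs, refMeasure, ← map_base hM j,
    Measure.prod_apply (hT hs)]
  refine lintegral_congr_ae ?_
  filter_upwards [hM.condLaw_ups j] with a ha
  change (condDistrib (M.upsBlock T j) (fun ω => (M.chan j ω, (fun n => M.phase T j n ω),
    M.noiseBlock T j ω)) P a) _ = _
  rw [ha]
  have hpi : (circGaussianPi fun _ : Fin T × Fin N => 1).map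
      (fun z i => ((√(distVar S.kappa (M.power P i.1) a.1 i.2) : ℝ) : ℂ) * z i) =
      Measure.pi fun i : Fin T × Fin N =>
        circGaussian (M.upsVar P S (i.1 + 1) a.1 i.2).toNNReal := by
    have hnn : ∀ i : Fin T × Fin N, 0 ≤ M.upsVar P S (i.1 + 1) a.1 i.2 := fun i =>
      distVar_nonneg S.kappa (M.power_nonneg P i.1) a.1 i.2
    have hmul := fun i : Fin T × Fin N => circGaussian_map_mul
      (√(distVar S.kappa (M.power P i.1) a.1 i.2)) (M.upsVar P S (i.1 + 1) a.1 i.2).toNNReal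
      (by rw [Real.coe_toNNReal _ (hnn i)]; exact Real.sq_sqrt (hnn i))
    exact (measurePreserving_pi _ _ fun i => ⟨by fun_prop, hmul i⟩).map_eq
  rw [← hpi, Measure.map_apply (by fun_prop) (measurable_prodMk_left hs)]
  rfl

lemma integral_base_upsBlock (hM : IsHardwareUplink P T S M) (j : Fin L)
    {f : BlockSpace L K N T → ℂ} (hf : Continuous f) :
    ∫ ω, f (M.base T j ω, M.upsBlock T j ω) ∂P =
      ∫ q, f (M.scaled P T S.kappa q) ∂(M.refMeasure P T j) := by
  have hm := (measurable_base hM j).prodMk (measurable_upsBlock hM j)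
  rw [← integral_map hm.aemeasurable hf.aestronglyMeasurable, map_base_upsBlock hM j,
    integral_map (M.measurable_scaled P T S.kappa).aemeasurable
      hf.aestronglyMeasurable]

lemma hasAllMoments_base_upsBlock (hM : IsHardwareUplink P T S M) (j : Fin L)
    {f : BlockSpace L K N T → ℂ} (hf : Continuous f)
    (h : HasAllMoments (fun q => f (M.scaled P T S.kappa q)) (M.refMeasure P T j)) :
    HasAllMoments (fun ω => f (M.base T j ω, M.upsBlock T j ω)) P := by
  intro p hp
  have hm := (measurable_base hM j).prodMk (measurable_upsBlock hM j)
  have h1 := (memLp_map_measure_iff hf.aestronglyMeasurable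
    (M.measurable_scaled P T S.kappa).aemeasurable).2 (h p hp)
  rw [← map_base_upsBlock hM j] at h1
  exact (memLp_map_measure_iff hf.aestronglyMeasurable hm.aemeasurable).1 h1

end Transfer

/-! ### Channel moments -/

/-- The superposition `∑ c_{lkn} x_{lk}` of the symbols `x` received at antenna `n` through the
channels `c`. -/
noncomputable def faded {L K N : ℕ} (x : Fin L × Fin K → ℂ) (n : Fin N)
    (c : Fin L → Fin K → Fin N → ℂ) : ℂ :=
  ∑ g : Fin L × Fin K, c g.1 g.2 n * x g

@[fun_prop]
lemma continuous_faded {L K N : ℕ} (x : Fin L × Fin K → ℂ) (n : Fin N) :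
    Continuous (faded x n : (Fin L → Fin K → Fin N → ℂ) → ℂ) := by
  unfold faded; fun_prop

lemma distVar_eq_sum {L K N : ℕ} (κ : ℝ) (p : Fin L → Fin K → ℝ)
    (c : Fin L → Fin K → Fin N → ℂ) (n : Fin N) :
    ((distVar κ p c n : ℝ) : ℂ) =
      κ ^ 2 * ∑ g : Fin L × Fin K, (p g.1 g.2 : ℂ) * (c g.1 g.2 n * star (c g.1 g.2 n)) := by
  rw [distVar, Fintype.sum_prod_type]
  push_cast
  simp_rw [Complex.star_def, Complex.mul_conj']

section Channel

variable {L K N B T : ℕ} {Ω : Type*} [MeasurableSpace Ω] {P : Measure Ω}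
    [IsProbabilityMeasure P] {S : UplinkParams L K B} {M : UplinkSignals L K N Ω}

lemma measurePreserving_chan (hM : IsHardwareUplink P T S M) (j : Fin L) :
    MeasurePreserving (fun (c : Fin L → Fin K → Fin N → ℂ) (i : Fin L × Fin K × Fin N) =>
      c i.1 i.2.1 i.2.2) (P.map (M.chan j))
      (circGaussianPi fun i : Fin L × Fin K × Fin N => (S.lam j i.1 i.2.1).toNNReal) := by
  refine ⟨by fun_prop, ?_⟩
  rw [Measure.map_map (by fun_prop) (measurable_chan hM j)]
  have h := (iIndepFun_iff_map_fun_eq_pi_map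
    fun i : Fin L × Fin K × Fin N => (hM.measurable_h j i.1 i.2.1 i.2.2).aemeasurable).1
      (hM.indep_h j)
  simp_rw [(hM.law_h j _ _ _).map_eq] at h
  exact h

lemma hasAllMoments_chan (hM : IsHardwareUplink P T S M) (j : Fin L) (g : Fin L × Fin K)
    (n : Fin N) : HasAllMoments (fun c => c g.1 g.2 n) (P.map (M.chan j)) :=
  HasAllMoments.comp_measurePreserving
    (hasAllMoments_circGaussianPi_eval _ ((g.1, g.2, n) : Fin L × Fin K × Fin N))
    (measurePreserving_chan hM j)

lemma hasAllMoments_faded (hM : IsHardwareUplink P T S M) (j : Fin L) (x : Fin L × Fin K → ℂ)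
    (n : Fin N) : HasAllMoments (faded x n) (P.map (M.chan j)) := by
  have := isProbabilityMeasure_chan hM j
  exact HasAllMoments.sum fun g _ => (hasAllMoments_chan hM j g n).mul (HasAllMoments.const (x g))

lemma coe_toNNReal_lam (S : UplinkParams L K B) (j l : Fin L) (k : Fin K) :
    (((S.lam j l k).toNNReal : ℝ) : ℂ) = (S.lam j l k : ℂ) := by
  rw [Real.coe_toNNReal _ (S.lam_pos j l k).le]

lemma integral_chan_mul_star (hM : IsHardwareUplink P T S M) (j : Fin L) (g g' : Fin L × Fin K)
    (n n' : Fin N) :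
    ∫ c, c g.1 g.2 n * star (c g'.1 g'.2 n') ∂(P.map (M.chan j)) =
      if g = g' ∧ n = n' then (S.lam j g.1 g.2 : ℂ) else 0 := by
  have hp := measurePreserving_chan hM j
  have h := integral_circGaussianPi_mul_star
    (fun i : Fin L × Fin K × Fin N => (S.lam j i.1 i.2.1).toNNReal) (g.1, g.2, n) (g'.1, g'.2, n')
  rw [← hp.map_eq, integral_map hp.measurable.aemeasurable
    (Continuous.aestronglyMeasurable (by fun_prop))] at h
  rw [h, coe_toNNReal_lam]
  congr 1
  simp [Prod.ext_iff, and_assoc]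

lemma integral_chan_four (hM : IsHardwareUplink P T S M) (j : Fin L) (a b c d : Fin L × Fin K)
    (na nb nc nd : Fin N) :
    ∫ z, z a.1 a.2 na * star (z b.1 b.2 nb) * (z c.1 c.2 nc * star (z d.1 d.2 nd))
        ∂(P.map (M.chan j)) =
      (if (a = b ∧ na = nb) ∧ c = d ∧ nc = nd then
        (S.lam j a.1 a.2 : ℂ) * (S.lam j c.1 c.2 : ℂ) else 0) +
      (if (a = d ∧ na = nd) ∧ c = b ∧ nc = nb then
        (S.lam j a.1 a.2 : ℂ) * (S.lam j c.1 c.2 : ℂ) else 0) := by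
  have hp := measurePreserving_chan hM j
  have h := integral_circGaussianPi_fourth
    (fun i : Fin L × Fin K × Fin N => (S.lam j i.1 i.2.1).toNNReal)
    (a.1, a.2, na) (b.1, b.2, nb) (c.1, c.2, nc) (d.1, d.2, nd)
  rw [← hp.map_eq, integral_map hp.measurable.aemeasurable
    (Continuous.aestronglyMeasurable (by fun_prop))] at h
  rw [h, coe_toNNReal_lam, coe_toNNReal_lam]
  congr 2 <;> simp [Prod.ext_iff, and_assoc]

lemma integral_faded_weighted (hM : IsHardwareUplink P T S M) (j : Fin L)
    (x x' : Fin L × Fin K → ℂ) (n n' : Fin N) {G : (Fin L → Fin K → Fin N → ℂ) → ℂ}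
    (hG : HasAllMoments G (P.map (M.chan j))) :
    ∫ c, faded x n c * star (faded x' n' c) * G c ∂(P.map (M.chan j)) =
      ∑ a, ∑ b, x a * star (x' b) *
        ∫ c, c a.1 a.2 n * star (c b.1 b.2 n') * G c ∂(P.map (M.chan j)) := by
  have hint : ∀ a b : Fin L × Fin K, Integrable (fun c => x a * star (x' b) *
      (c a.1 a.2 n * star (c b.1 b.2 n') * G c)) (P.map (M.chan j)) := fun a b =>
    ((((hasAllMoments_chan hM j a n).mul (hasAllMoments_chan hM j b n').star).mul hG).const_mul
      _).integrable
  have e : ∀ c : Fin L → Fin K → Fin N → ℂ, faded x n c * star (faded x' n' c) * G c =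
      ∑ a, ∑ b, x a * star (x' b) * (c a.1 a.2 n * star (c b.1 b.2 n') * G c) := by
    intro c
    rw [faded, faded, star_sum, Finset.sum_mul_sum, Finset.sum_mul]
    refine Finset.sum_congr rfl fun a _ => ?_
    rw [Finset.sum_mul]
    refine Finset.sum_congr rfl fun b _ => ?_
    rw [star_mul']; ring
  simp_rw [e]
  rw [integral_finsetSum _ fun a _ => integrable_finsetSum _ fun b _ => hint a b]
  refine Finset.sum_congr rfl fun a _ => ?_
  rw [integral_finsetSum _ fun b _ => hint a b]
  simp_rw [integral_const_mul]

lemma integral_faded_mul_star (hM : IsHardwareUplink P T S M) (j : Fin L)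
    (x x' : Fin L × Fin K → ℂ) (n n' : Fin N) :
    ∫ c, faded x n c * star (faded x' n' c) ∂(P.map (M.chan j)) =
      if n = n' then ∑ a : Fin L × Fin K, (S.lam j a.1 a.2 : ℂ) * (x a * star (x' a)) else 0 := by
  have := isProbabilityMeasure_chan hM j
  have h := integral_faded_weighted hM j x x' n n' (HasAllMoments.const 1)
  simp only [mul_one, integral_chan_mul_star hM] at h
  rw [h]
  split_ifs with hn
  · simp [hn, mul_comm]
  · simp [hn]

lemma integral_faded_fourth (hM : IsHardwareUplink P T S M) (j : Fin L)
    (x x' : Fin L × Fin K → ℂ) (g : Fin L × Fin K) (n n' : Fin N) :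
    ∫ c, faded x n c * star (faded x' n' c) * (c g.1 g.2 n' * star (c g.1 g.2 n))
      ∂(P.map (M.chan j)) =
      (if n = n' then (S.lam j g.1 g.2 : ℂ) *
        ∑ a : Fin L × Fin K, (S.lam j a.1 a.2 : ℂ) * (x a * star (x' a)) else 0) +
      (S.lam j g.1 g.2 : ℂ) ^ 2 * (x g * star (x' g)) := by
  rw [integral_faded_weighted hM j x x' n n'
    ((hasAllMoments_chan hM j g n').mul (hasAllMoments_chan hM j g n).star)]
  simp only [integral_chan_four hM, mul_add, Finset.sum_add_distrib]
  congr 1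
  · split_ifs with hn
    · subst hn
      simp only [and_true, mul_ite, mul_zero, Finset.sum_ite_eq, Finset.mem_univ, if_true,
        Finset.mul_sum]
      exact Finset.sum_congr rfl fun a _ => by ring
    · simp [hn]
  · rw [Finset.sum_eq_single g, Finset.sum_eq_single g]
    · simp; ring
    · intro b _ hb; simp [Ne.symm hb]
    · simp
    · intro a _ ha; simp [ha]
    · simp

lemma integral_chan_distVar (hM : IsHardwareUplink P T S M) (j : Fin L) (κ : ℝ)
    (p : Fin L → Fin K → ℝ) (n : Fin N) {G : (Fin L → Fin K → Fin N → ℂ) → ℂ}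
    (hG : HasAllMoments G (P.map (M.chan j))) :
    ∫ c, G c * ((distVar κ p c n : ℝ) : ℂ) ∂(P.map (M.chan j)) =
      κ ^ 2 * ∑ g : Fin L × Fin K, (p g.1 g.2 : ℂ) *
        ∫ c, G c * (c g.1 g.2 n * star (c g.1 g.2 n)) ∂(P.map (M.chan j)) := by
  have e : ∀ c : Fin L → Fin K → Fin N → ℂ, G c * ((distVar κ p c n : ℝ) : ℂ) =
      ∑ g : Fin L × Fin K, κ ^ 2 * ((p g.1 g.2 : ℂ) *
        (G c * (c g.1 g.2 n * star (c g.1 g.2 n)))) := by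
    intro c
    rw [distVar_eq_sum, Finset.mul_sum, Finset.mul_sum]
    exact Finset.sum_congr rfl fun g _ => by ring
  simp_rw [e]
  rw [integral_finsetSum _ fun g _ => (((hG.mul ((hasAllMoments_chan hM j g n).mul
    (hasAllMoments_chan hM j g n).star)).const_mul _).const_mul _).integrable, Finset.mul_sum]
  simp_rw [integral_const_mul]

lemma integral_distVar (hM : IsHardwareUplink P T S M) (j : Fin L) (κ : ℝ)
    (p : Fin L → Fin K → ℝ) (n : Fin N) :
    ∫ c, ((distVar κ p c n : ℝ) : ℂ) ∂(P.map (M.chan j)) =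
      κ ^ 2 * ∑ g : Fin L × Fin K, (p g.1 g.2 : ℂ) * (S.lam j g.1 g.2 : ℂ) := by
  have := isProbabilityMeasure_chan hM j
  have h := integral_chan_distVar hM j κ p n (HasAllMoments.const 1)
  simp only [one_mul, integral_chan_mul_star hM, and_self, if_true] at h
  exact h

lemma integral_distVar_mul_chan (hM : IsHardwareUplink P T S M) (j : Fin L) (κ : ℝ)
    (p : Fin L → Fin K → ℝ) (g : Fin L × Fin K) (n : Fin N) :
    ∫ c, ((distVar κ p c n : ℝ) : ℂ) * (c g.1 g.2 n * star (c g.1 g.2 n)) ∂(P.map (M.chan j)) =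
      (S.lam j g.1 g.2 : ℂ) *
        (κ ^ 2 * ∑ a : Fin L × Fin K, (p a.1 a.2 : ℂ) * (S.lam j a.1 a.2 : ℂ)) +
      (S.lam j g.1 g.2 : ℂ) ^ 2 * (κ ^ 2 * (p g.1 g.2 : ℂ)) := by
  have h := integral_chan_distVar hM j κ p n
    ((hasAllMoments_chan hM j g n).mul (hasAllMoments_chan hM j g n).star)
  simp_rw [mul_comm (((distVar κ p _ n : ℝ) : ℂ))]
  rw [h]
  simp only [integral_chan_four hM, mul_add, Finset.sum_add_distrib]
  congr 1
  · simp only [and_self, if_true, Finset.mul_sum]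
    exact Finset.sum_congr rfl fun a _ => by ring
  · rw [Finset.sum_eq_single g]
    · simp; ring
    · intro b _ hb; simp [hb]
    · simp

/-- The conditional standard deviation of the distortion noise has all moments. -/
lemma hasAllMoments_sqrt_distVar (hM : IsHardwareUplink P T S M) (j : Fin L) (κ : ℝ)
    {p : Fin L → Fin K → ℝ} (hp : ∀ l k, 0 ≤ p l k) (n : Fin N) :
    HasAllMoments (fun c => ((√(distVar κ p c n) : ℝ) : ℂ)) (P.map (M.chan j)) := by
  have := isProbabilityMeasure_chan hM j
  -- `√x ≤ x + 1`, and `distVar` is a polynomial in the channels.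
  have h1 : HasAllMoments (fun c => ((distVar κ p c n : ℝ) : ℂ) + 1) (P.map (M.chan j)) := by
    simp_rw [distVar_eq_sum]
    refine HasAllMoments.add (HasAllMoments.const_mul _ (HasAllMoments.sum fun g _ =>
      HasAllMoments.const_mul _ ((hasAllMoments_chan hM j g n).mul
        (hasAllMoments_chan hM j g n).star))) (HasAllMoments.const 1)
  refine h1.mono (Continuous.aestronglyMeasurable (by fun_prop)) fun c => ?_
  have h0 := distVar_nonneg κ hp c n
  rw [← Complex.ofReal_one, ← Complex.ofReal_add, Complex.norm_of_nonneg (Real.sqrt_nonneg _),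
    Complex.norm_of_nonneg (by linarith)]
  rw [Real.sqrt_le_left (by linarith)]
  nlinarith

lemma sqrt_distVar_mul_star {κ : ℝ} {p : Fin L → Fin K → ℝ} (hp : ∀ l k, 0 ≤ p l k)
    (c : Fin L → Fin K → Fin N → ℂ) (n : Fin N) :
    ((√(distVar κ p c n) : ℝ) : ℂ) * star ((√(distVar κ p c n) : ℝ) : ℂ) =
      ((distVar κ p c n : ℝ) : ℂ) := by
  rw [Complex.star_def, Complex.conj_ofReal, ← Complex.ofReal_mul,
    Real.mul_self_sqrt (distVar_nonneg κ hp c n)]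

/-! ### Thermal noise moments -/

lemma noiseBlock_law (hM : IsHardwareUplink P T S M) (j : Fin L) :
    P.map (M.noiseBlock T j) =
      circGaussianPi fun _ : Fin T × Fin N => (S.sigma ^ 2).toNNReal := by
  have h := (iIndepFun_iff_map_fun_eq_pi_map
    fun i : Fin T × Fin N => (hM.measurable_noise j (i.1 + 1) i.2).aemeasurable).1
      (hM.indep_noise j)
  have e : ∀ i : Fin T × Fin N, P.map (M.noise j (i.1 + 1) i.2) =
      circGaussian (S.sigma ^ 2).toNNReal := fun i =>
    (hM.law_noise j (i.1 + 1) i.2 (by omega) (by omega)).map_eq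
  simp_rw [e] at h
  exact h

end Channel

/-! ### Entries of the covariance matrices -/

namespace UplinkParams

variable {L K B : ℕ} (S : UplinkParams L K B)

/-- The pilot symbols of all users at one channel use. -/
def symbols (b : Fin B) (g : Fin L × Fin K) : ℂ := S.pilot g.1 g.2 b

/-- The powers of the pilot symbols of all users at one channel use. -/
noncomputable def pilotPower (b : Fin B) (l : Fin L) (k : Fin K) : ℝ := ‖S.pilot l k b‖ ^ 2

lemma pilotPower_nonneg (b : Fin B) (l : Fin L) (k : Fin K) : 0 ≤ S.pilotPower b l k :=
  sq_nonneg _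

lemma X_apply (l : Fin L) (m : Fin K) (b b' : Fin B) :
    S.X l m b b' = S.pilot l m b * star (S.pilot l m b') * phaseCorr S.delta b b' +
      if b = b' then (S.kappa : ℂ) ^ 2 * (S.pilotPower b l m : ℂ) else 0 := by
  rw [X, Matrix.of_apply]
  split_ifs with h
  · subst h
    rw [phaseCorr_self, Complex.star_def, Complex.mul_conj', pilotPower]
    push_cast; ring
  · rw [add_zero]; rfl

lemma Psi_apply (j : Fin L) (b b' : Fin B) :
    S.Psi j b b' = ∑ g : Fin L × Fin K, (S.lam j g.1 g.2 : ℂ) * S.X g.1 g.2 b b' +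
      if b = b' then ((S.sigma ^ 2 * S.xi : ℝ) : ℂ) else 0 := by
  rw [Psi, Matrix.add_apply, Fintype.sum_prod_type, Matrix.smul_apply, Matrix.one_apply]
  simp [Matrix.sum_apply]

/-- An entry of `Ψ` as the sum of its signal, distortion and noise parts. -/
lemma Psi_apply_parts (j : Fin L) (b b' : Fin B) :
    S.Psi j b b' = (∑ g : Fin L × Fin K, (S.lam j g.1 g.2 : ℂ) *
        (S.symbols b g * star (S.symbols b' g))) * phaseCorr S.delta b b' +
      if b = b' then (S.kappa : ℂ) ^ 2 * ∑ g : Fin L × Fin K,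
        (S.pilotPower b g.1 g.2 : ℂ) * (S.lam j g.1 g.2 : ℂ) +
        ((S.sigma ^ 2 * S.xi : ℝ) : ℂ) else 0 := by
  rw [Psi_apply]
  simp only [X_apply, mul_add, Finset.sum_add_distrib]
  split_ifs with h
  · rw [Finset.sum_mul, Finset.mul_sum, ← add_assoc]
    congr 1
    congr 1
    · exact Finset.sum_congr rfl fun g _ => by simp only [symbols]; ring
    · exact Finset.sum_congr rfl fun g _ => by ring
  · simp only [mul_zero, Finset.sum_const_zero, add_zero, Finset.sum_mul]
    exact Finset.sum_congr rfl fun g _ => by simp only [symbols]; ring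

lemma D_apply_eq_phaseCorr (s : ℕ) (h : B ≤ s + 1) :
    S.D (s + 1) = Matrix.diagonal fun i : Fin B => phaseCorr S.delta s i := by
  rw [D]
  congr 1
  funext i
  have hi : ((i : ℕ) : ℝ) ≤ s := by exact_mod_cast (by omega : (i : ℕ) ≤ s)
  rw [phaseCorr, abs_of_nonneg (by linarith)]
  push_cast
  ring_nf

end UplinkParams

/-! ### Moments of the received signal -/

namespace UplinkSignals

variable {L K N B T : ℕ} {Ω : Type*} [MeasurableSpace Ω]

/-- The received pilot signal at antenna `n` as a function of channels, phases, thermal noise and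
distortion noise. -/
noncomputable def recv (S : UplinkParams L K B) (hBT : B ≤ T) (n : Fin N) (b : Fin B)
    (q : BlockSpace L K N T) : ℂ :=
  phasor n (Fin.castLE hBT b) q.1.2.1 * faded (S.symbols b) n q.1.1 +
    q.2 (Fin.castLE hBT b, n) + ((√S.xi : ℝ) : ℂ) * q.1.2.2 (Fin.castLE hBT b, n)

lemma continuous_recv (S : UplinkParams L K B) (hBT : B ≤ T) (n : Fin N) (b : Fin B) :
    Continuous (recv S hBT n b) := by
  unfold recv phasor; fun_prop

end UplinkSignals

section ReceivedMoments

variable {L K N B T : ℕ} {Ω : Type*} [MeasurableSpace Ω] {P : Measure Ω}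
    [IsProbabilityMeasure P] {S : UplinkParams L K B} {M : UplinkSignals L K N Ω}

lemma received_eq_recv (hM : IsHardwareUplink P T S M) (hBT : B ≤ T) (j : Fin L) (n : Fin N)
    (b : Fin B) (ω : Ω) :
    M.received S j (b + 1) ω n = recv S hBT n b (M.base T j ω, M.upsBlock T j ω) := by
  simp only [received, hM.x_pilot, recv, faded, Fintype.sum_prod_type]
  rfl

lemma power_pilot (hM : IsHardwareUplink P T S M) (b : Fin B) :
    M.power P b = S.pilotPower b := by
  funext l k
  simp [power, hM.x_pilot, UplinkParams.pilotPower]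

lemma power_data (hM : IsHardwareUplink P T S M) (s : Fin T) (h : B ≤ s) :
    M.power P s = S.p := by
  funext l k
  exact hM.x_data_power l k (s + 1) (by omega) (by omega)

lemma recv_scaled (hM : IsHardwareUplink P T S M) (hBT : B ≤ T) (n : Fin N) (b : Fin B)
    (q : BlockSpace L K N T) :
    recv S hBT n b (M.scaled P T S.kappa q) =
      phasor n (Fin.castLE hBT b) q.1.2.1 * faded (S.symbols b) n q.1.1 +
      ((√(distVar S.kappa (S.pilotPower b) q.1.1 n) : ℝ) : ℂ) * q.2 (Fin.castLE hBT b, n) +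
      ((√S.xi : ℝ) : ℂ) * q.1.2.2 (Fin.castLE hBT b, n) := by
  rw [← power_pilot hM]; rfl

lemma hasAllMoments_phasor (hM : IsHardwareUplink P T S M) (j : Fin L) (n : Fin N) (s : Fin T) :
    HasAllMoments (phasor n s) (M.phaseLaw P T j) := by
  have := isProbabilityMeasure_phaseLaw hM j
  exact HasAllMoments.of_bound (continuous_phasor n s).aestronglyMeasurable 1
    fun φ => (norm_phasor n s φ).le

lemma hasAllMoments_noise (hM : IsHardwareUplink P T S M) (j : Fin L) (i : Fin T × Fin N) :
    HasAllMoments (fun w => ((√S.xi : ℝ) : ℂ) * w i) (P.map (M.noiseBlock T j)) := by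
  rw [noiseBlock_law hM j]
  exact (hasAllMoments_circGaussianPi_eval _ i).const_mul _

/-- The second moments of the received pilot signal under a weight that depends on the channels,
the phases and the normalised distortion. The weight in the distortion must keep it centred and
uncorrelated. -/
lemma integral_recv_mul_star (hM : IsHardwareUplink P T S M) (hBT : B ≤ T) (j : Fin L)
    (n n' : Fin N) (b b' : Fin B) {gC : (Fin L → Fin K → Fin N → ℂ) → ℂ}
    {gΦ : (Fin N → Fin T → ℝ) → ℂ} {gZ : (Fin T × Fin N → ℂ) → ℂ}
    (hgC : HasAllMoments gC (P.map (M.chan j))) (hgΦ : HasAllMoments gΦ (M.phaseLaw P T j))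
    (hgZ : HasAllMoments gZ (circGaussianPi fun _ => 1))
    (hz0 : ∫ z, z (Fin.castLE hBT b, n) * gZ z ∂(circGaussianPi fun _ => 1) = 0)
    (hz0' : ∫ z, star (z (Fin.castLE hBT b', n')) * gZ z ∂(circGaussianPi fun _ => 1) = 0)
    (hzz : ∫ z, z (Fin.castLE hBT b, n) * star (z (Fin.castLE hBT b', n')) * gZ z
      ∂(circGaussianPi fun _ => 1) =
        if b = b' ∧ n = n' then ∫ z, gZ z ∂(circGaussianPi fun _ => 1) else 0) :
    ∫ q, recv S hBT n b (M.scaled P T S.kappa q) *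
        star (recv S hBT n' b' (M.scaled P T S.kappa q)) *
        (gC q.1.1 * gΦ q.1.2.1 * gZ q.2) ∂(M.refMeasure P T j) =
      ((∫ c, faded (S.symbols b) n c * star (faded (S.symbols b') n' c) * gC c
          ∂(P.map (M.chan j))) *
        (∫ φ, phasor n (Fin.castLE hBT b) φ * star (phasor n' (Fin.castLE hBT b') φ) * gΦ φ
          ∂(M.phaseLaw P T j)) +
        if b = b' ∧ n = n' then
          ((∫ c, ((distVar S.kappa (S.pilotPower b) c n : ℝ) : ℂ) * gC c ∂(P.map (M.chan j))) +
            ((S.sigma ^ 2 * S.xi : ℝ) : ℂ) * ∫ c, gC c ∂(P.map (M.chan j))) *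
          ∫ φ, gΦ φ ∂(M.phaseLaw P T j) else 0) *
      ∫ z, gZ z ∂(circGaussianPi fun _ => 1) := by
  have := isProbabilityMeasure_chan hM j
  have := isProbabilityMeasure_phaseLaw hM j
  have := isProbabilityMeasure_noiseBlock hM j
  simp_rw [recv_scaled hM]
  have hσ : (((S.sigma ^ 2).toNNReal : ℝ) : ℂ) = ((S.sigma ^ 2 : ℝ) : ℂ) := by
    rw [Real.coe_toNNReal _ (sq_nonneg _)]
  have hw0 : ∀ i, ∫ w, ((√S.xi : ℝ) : ℂ) * w i ∂(P.map (M.noiseBlock T j)) = 0 := fun i => by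
    rw [integral_const_mul, noiseBlock_law hM j, integral_circGaussianPi_coord, mul_zero]
  have hw0' : ∀ i, ∫ w, star (((√S.xi : ℝ) : ℂ) * w i) ∂(P.map (M.noiseBlock T j)) = 0 := by
    intro i
    simp_rw [star_mul']
    rw [integral_const_mul, noiseBlock_law hM j, integral_circGaussianPi_star, mul_zero]
  have hww : ∀ i i' : Fin T × Fin N, ∫ w, ((√S.xi : ℝ) : ℂ) * w i * star (((√S.xi : ℝ) : ℂ) * w i')
      ∂(P.map (M.noiseBlock T j)) = if i = i' then ((S.sigma ^ 2 * S.xi : ℝ) : ℂ) else 0 := by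
    intro i i'
    have e : ∀ w : Fin T × Fin N → ℂ, ((√S.xi : ℝ) : ℂ) * w i * star (((√S.xi : ℝ) : ℂ) * w i') =
        ((S.xi : ℝ) : ℂ) * (w i * star (w i')) := by
      intro w
      rw [star_mul', Complex.star_def, Complex.conj_ofReal]
      have : ((S.xi : ℝ) : ℂ) = ((√S.xi : ℝ) : ℂ) * ((√S.xi : ℝ) : ℂ) := by
        rw [← Complex.ofReal_mul, Real.mul_self_sqrt (by linarith [S.one_le_xi])]
      rw [this]; ring
    simp_rw [e]
    rw [integral_const_mul, noiseBlock_law hM j, integral_circGaussianPi_mul_star, hσ]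
    split_ifs
    · push_cast; ring
    · simp
  have h := integral_signal_mul_star
    (hasAllMoments_faded hM j (S.symbols b) n) (hasAllMoments_faded hM j (S.symbols b') n')
    (hasAllMoments_sqrt_distVar hM j S.kappa (S.pilotPower_nonneg b) n)
    (hasAllMoments_sqrt_distVar hM j S.kappa (S.pilotPower_nonneg b') n') hgC
    (hasAllMoments_phasor hM j n (Fin.castLE hBT b))
    (hasAllMoments_phasor hM j n' (Fin.castLE hBT b')) hgΦ
    (hasAllMoments_noise hM j (Fin.castLE hBT b, n))
    (hasAllMoments_noise hM j (Fin.castLE hBT b', n'))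
    (hasAllMoments_circGaussianPi_eval _ (Fin.castLE hBT b, n))
    (hasAllMoments_circGaussianPi_eval _ (Fin.castLE hBT b', n')) hgZ
    (hw0 _) (hw0' _) hz0 hz0'
  rw [hzz, hww] at h
  refine h.trans ?_
  have hcast : (Fin.castLE hBT b, n) = (Fin.castLE hBT b', n') ↔ b = b' ∧ n = n' := by
    simp [Prod.ext_iff, Fin.ext_iff]
  by_cases hbn : b = b' ∧ n = n'
  · rw [if_pos (hcast.2 hbn)]
    obtain ⟨rfl, rfl⟩ := hbn
    simp only [and_self, if_true]
    simp_rw [sqrt_distVar_mul_star (S.pilotPower_nonneg b)]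
    ring
  · rw [if_neg (fun h => hbn (hcast.1 h)), if_neg hbn, if_neg hbn]
    ring

end ReceivedMoments

/-- The effective channel at antenna `n` as a function of channels and phases. -/
noncomputable def effCoord {L K N T : ℕ} (g : Fin L × Fin K) (n : Fin N) (s : Fin T)
    (q : BlockSpace L K N T) : ℂ :=
  phasor n s q.1.2.1 * q.1.1 g.1 g.2 n

lemma continuous_effCoord {L K N T : ℕ} (g : Fin L × Fin K) (n : Fin N) (s : Fin T) :
    Continuous (effCoord g n s) := by
  unfold effCoord phasor; fun_prop

lemma effChan_eq_effCoord {L K N T : ℕ} {Ω : Type*} (M : UplinkSignals L K N Ω) (j : Fin L)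
    (g : Fin L × Fin K) (n : Fin N) (s : Fin T) (ω : Ω) :
    M.effChan j g.1 g.2 (s + 1) ω n = effCoord g n s (M.base T j ω, M.upsBlock T j ω) := rfl

section ObservationMoments

variable {L K N B T : ℕ} {Ω : Type*} [MeasurableSpace Ω] {P : Measure Ω}
    [IsProbabilityMeasure P] {S : UplinkParams L K B} {M : UplinkSignals L K N Ω}

lemma UplinkParams.weighted_Psi_parts (S : UplinkParams L K B) (j : Fin L) (g : Fin L × Fin K)
    (b b' : Fin B) :
    ((S.lam j g.1 g.2 : ℂ) * (∑ a : Fin L × Fin K, (S.lam j a.1 a.2 : ℂ) *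
        (S.symbols b a * star (S.symbols b' a))) +
      (S.lam j g.1 g.2 : ℂ) ^ 2 * (S.symbols b g * star (S.symbols b' g))) *
        phaseCorr S.delta b b' +
      (if b = b' then
        ((S.lam j g.1 g.2 : ℂ) * (S.kappa ^ 2 * ∑ a : Fin L × Fin K,
          (S.pilotPower b a.1 a.2 : ℂ) * (S.lam j a.1 a.2 : ℂ)) +
        (S.lam j g.1 g.2 : ℂ) ^ 2 * (S.kappa ^ 2 * (S.pilotPower b g.1 g.2 : ℂ))) +
        ((S.sigma ^ 2 * S.xi : ℝ) : ℂ) * (S.lam j g.1 g.2 : ℂ) else 0) =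
      (S.lam j g.1 g.2 : ℂ) * S.Psi j b b' +
        (S.lam j g.1 g.2 : ℂ) ^ 2 * S.X g.1 g.2 b b' := by
  rw [Psi_apply_parts, X_apply]
  simp only [symbols]
  split_ifs <;> ring

lemma hasAllMoments_ref_chan (hM : IsHardwareUplink P T S M) (j : Fin L)
    {f : (Fin L → Fin K → Fin N → ℂ) → ℂ} (hf : HasAllMoments f (P.map (M.chan j))) :
    HasAllMoments (fun q => f q.1.1) (M.refMeasure P T j) := by
  have := isProbabilityMeasure_chan hM j
  have := isProbabilityMeasure_phaseLaw hM j
  have := isProbabilityMeasure_noiseBlock hM j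
  exact (hf.comp_measurePreserving measurePreserving_fst).comp_measurePreserving
    measurePreserving_fst

lemma hasAllMoments_ref_phase (hM : IsHardwareUplink P T S M) (j : Fin L)
    {f : (Fin N → Fin T → ℝ) → ℂ} (hf : HasAllMoments f (M.phaseLaw P T j)) :
    HasAllMoments (fun q => f q.1.2.1) (M.refMeasure P T j) := by
  have := isProbabilityMeasure_chan hM j
  have := isProbabilityMeasure_phaseLaw hM j
  have := isProbabilityMeasure_noiseBlock hM j
  exact ((hf.comp_measurePreserving measurePreserving_fst).comp_measurePreserving
    measurePreserving_snd).comp_measurePreserving measurePreserving_fst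

lemma hasAllMoments_ref_noise (hM : IsHardwareUplink P T S M) (j : Fin L)
    {f : (Fin T × Fin N → ℂ) → ℂ} (hf : HasAllMoments f (P.map (M.noiseBlock T j))) :
    HasAllMoments (fun q => f q.1.2.2) (M.refMeasure P T j) := by
  have := isProbabilityMeasure_chan hM j
  have := isProbabilityMeasure_phaseLaw hM j
  have := isProbabilityMeasure_noiseBlock hM j
  exact ((hf.comp_measurePreserving measurePreserving_snd).comp_measurePreserving
    measurePreserving_snd).comp_measurePreserving measurePreserving_fst

lemma hasAllMoments_ref_ups (hM : IsHardwareUplink P T S M) (j : Fin L) (i : Fin T × Fin N) :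
    HasAllMoments (fun q => (M.scaled P T S.kappa q).2 i) (M.refMeasure P T j) := by
  have := isProbabilityMeasure_chan hM j
  have := isProbabilityMeasure_phaseLaw hM j
  have := isProbabilityMeasure_noiseBlock hM j
  exact (hasAllMoments_ref_chan hM j (hasAllMoments_sqrt_distVar hM j S.kappa
    (M.power_nonneg P i.1) i.2)).mul
    ((hasAllMoments_circGaussianPi_eval _ i).comp_measurePreserving measurePreserving_snd)

lemma hasAllMoments_received (hM : IsHardwareUplink P T S M) (hBT : B ≤ T) (j : Fin L)
    (n : Fin N) (b : Fin B) : HasAllMoments (fun ω => M.received S j (b + 1) ω n) P := by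
  simp_rw [received_eq_recv hM hBT]
  refine hasAllMoments_base_upsBlock hM j (continuous_recv S hBT n b) ?_
  exact (((hasAllMoments_ref_phase hM j (hasAllMoments_phasor hM j n (Fin.castLE hBT b))).mul
    (hasAllMoments_ref_chan hM j (hasAllMoments_faded hM j (S.symbols b) n))).add
    (hasAllMoments_ref_ups hM j (Fin.castLE hBT b, n))).add
    (hasAllMoments_ref_noise hM j (hasAllMoments_noise hM j (Fin.castLE hBT b, n)))

lemma hasAllMoments_effChan (hM : IsHardwareUplink P T S M) (j : Fin L) (g : Fin L × Fin K)
    (n : Fin N) (s : Fin T) : HasAllMoments (fun ω => M.effChan j g.1 g.2 (s + 1) ω n) P :=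
  hasAllMoments_base_upsBlock hM j (continuous_effCoord g n s)
    ((hasAllMoments_ref_phase hM j (hasAllMoments_phasor hM j n s)).mul
      (hasAllMoments_ref_chan hM j (hasAllMoments_chan hM j g n)))

lemma hasAllMoments_upsVec (hM : IsHardwareUplink P T S M) (j : Fin L) (n : Fin N)
    (s : Fin T) : HasAllMoments (fun ω => M.upsVec j (s + 1) ω n) P :=
  hasAllMoments_base_upsBlock hM j
    (f := fun q => q.2 (s, n)) (by fun_prop) (hasAllMoments_ref_ups hM j (s, n))

/-- The case of `integral_recv_mul_star` in which the weight does not involve the distortion. -/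
lemma integral_recv_mul_star_of_chan_phase (hM : IsHardwareUplink P T S M) (hBT : B ≤ T)
    (j : Fin L) (n n' : Fin N) (b b' : Fin B) {gC : (Fin L → Fin K → Fin N → ℂ) → ℂ}
    {gΦ : (Fin N → Fin T → ℝ) → ℂ}
    (hgC : HasAllMoments gC (P.map (M.chan j))) (hgΦ : HasAllMoments gΦ (M.phaseLaw P T j)) :
    ∫ q, recv S hBT n b (M.scaled P T S.kappa q) *
        star (recv S hBT n' b' (M.scaled P T S.kappa q)) *
        (gC q.1.1 * gΦ q.1.2.1) ∂(M.refMeasure P T j) =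
      (∫ c, faded (S.symbols b) n c * star (faded (S.symbols b') n' c) * gC c
          ∂(P.map (M.chan j))) *
        (∫ φ, phasor n (Fin.castLE hBT b) φ * star (phasor n' (Fin.castLE hBT b') φ) * gΦ φ
          ∂(M.phaseLaw P T j)) +
        if b = b' ∧ n = n' then
          ((∫ c, ((distVar S.kappa (S.pilotPower b) c n : ℝ) : ℂ) * gC c ∂(P.map (M.chan j))) +
            ((S.sigma ^ 2 * S.xi : ℝ) : ℂ) * ∫ c, gC c ∂(P.map (M.chan j))) *
          ∫ φ, gΦ φ ∂(M.phaseLaw P T j) else 0 := by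
  have hcast : (Fin.castLE hBT b, n) = (Fin.castLE hBT b', n') ↔ b = b' ∧ n = n' := by
    simp [Prod.ext_iff, Fin.ext_iff]
  have one : ∫ _, (1 : ℂ) ∂(circGaussianPi fun _ : Fin T × Fin N => 1) = 1 := by simp
  have h := integral_recv_mul_star hM hBT j n n' b b' hgC hgΦ
    (gZ := fun _ => 1) (HasAllMoments.const 1)
    (by simp only [mul_one]; exact integral_circGaussianPi_coord _ _)
    (by simp only [mul_one]; exact integral_circGaussianPi_star _ _)
    (by
      simp only [mul_one]
      rw [integral_circGaussianPi_mul_star, one]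
      simp only [hcast, NNReal.coe_one, Complex.ofReal_one])
  rw [one] at h
  simp only [mul_one] at h
  exact h

/-- The covariance of the pilot observation is `Ψ ⊗ I`. -/
lemma integral_received_mul_star (hM : IsHardwareUplink P T S M) (hBT : B ≤ T) (j : Fin L)
    (n n' : Fin N) (b b' : Fin B) :
    ∫ ω, M.received S j (b + 1) ω n * star (M.received S j (b' + 1) ω n') ∂P =
      if n = n' then S.Psi j b b' else 0 := by
  have := isProbabilityMeasure_chan hM j
  have := isProbabilityMeasure_phaseLaw hM j
  have h := integral_recv_mul_star_of_chan_phase hM hBT j n n' b b'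
    (HasAllMoments.const 1) (HasAllMoments.const 1)
  simp only [mul_one] at h
  have hc := continuous_recv (N := N) S hBT
  simp_rw [received_eq_recv hM hBT]
  rw [integral_base_upsBlock hM j (f := fun q => recv S hBT n b q * star (recv S hBT n' b' q))
    ((hc n b).mul (hc n' b').star), h, integral_faded_mul_star hM, integral_distVar hM]
  by_cases hn : n = n'
  · subst hn
    rw [integral_phasor hM, UplinkParams.Psi_apply_parts]
    simp
  · simp [hn]

/-- The correlation of an effective channel with the pilot observation. -/
lemma integral_effChan_mul_star (hM : IsHardwareUplink P T S M) (hBT : B ≤ T) (j : Fin L)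
    (g : Fin L × Fin K) (n n' : Fin N) (s : Fin T) (b : Fin B) :
    ∫ ω, M.effChan j g.1 g.2 (s + 1) ω n * star (M.received S j (b + 1) ω n') ∂P =
      if n = n' then (S.lam j g.1 g.2 : ℂ) * (star (S.symbols b g) * phaseCorr S.delta s b)
      else 0 := by
  have := isProbabilityMeasure_chan hM j
  have := isProbabilityMeasure_phaseLaw hM j
  have := isProbabilityMeasure_noiseBlock hM j
  have hc := continuous_recv (N := N) S hBT
  simp_rw [received_eq_recv hM hBT, effChan_eq_effCoord]
  rw [integral_base_upsBlock hM j (f := fun q => effCoord g n s q * star (recv S hBT n' b q))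
    ((continuous_effCoord g n s).mul (hc n' b).star)]
  simp_rw [recv_scaled hM]
  have hw0' : ∫ w, star (((√S.xi : ℝ) : ℂ) * w (Fin.castLE hBT b, n'))
      ∂(P.map (M.noiseBlock T j)) = 0 := by
    simp_rw [star_mul']
    rw [integral_const_mul, noiseBlock_law hM j, integral_circGaussianPi_star, mul_zero]
  have h := integral_signal_mul_star (gC := fun _ => 1) (gΦ := fun _ => 1) (gZ := fun _ => 1)
    (r := fun _ => 0) (w := fun _ => 0) (z := fun _ => 0)
    (hasAllMoments_chan hM j g n) (hasAllMoments_faded hM j (S.symbols b) n')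
    (HasAllMoments.const 0)
    (hasAllMoments_sqrt_distVar hM j S.kappa (S.pilotPower_nonneg b) n') (HasAllMoments.const 1)
    (hasAllMoments_phasor hM j n s)
    (hasAllMoments_phasor hM j n' (Fin.castLE hBT b)) (HasAllMoments.const 1)
    (HasAllMoments.const 0)
    (hasAllMoments_noise hM j (Fin.castLE hBT b, n'))
    (HasAllMoments.const 0)
    (hasAllMoments_circGaussianPi_eval (fun _ => 1) (Fin.castLE hBT b, n'))
    (HasAllMoments.const 1) (by simp) hw0' (by simp)
    (by simp only [mul_one]; exact integral_circGaussianPi_star _ _)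
  have hone : ∫ _, (1 : ℂ) ∂(circGaussianPi fun _ : Fin T × Fin N => 1) = 1 := by simp
  simp only [mul_one, zero_mul, add_zero, integral_zero, mul_zero, hone] at h
  refine h.trans ?_
  -- One channel coefficient is the superposition in which only user `g` sends, with symbol `1`.
  have hf : ∀ c : Fin L → Fin K → Fin N → ℂ, c g.1 g.2 n = faded (Pi.single g 1) n c := by
    intro c
    simp [faded, Pi.single_apply]
  simp_rw [hf]
  rw [integral_faded_mul_star hM]
  by_cases hn : n = n'
  · subst hn
    rw [integral_phasor hM]
    simp [Pi.single_apply]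
    ring
  · simp [hn]

/-- The fourth-order moments behind the second moments of the filter output. Equal antennas
contribute through the Gaussian fourth moment, distinct antennas through a product of
correlations. -/
lemma integral_received_effChan (hM : IsHardwareUplink P T S M) (hBT : B ≤ T) (j : Fin L)
    (g : Fin L × Fin K) (n n' : Fin N) (s : Fin T) (b b' : Fin B) :
    ∫ ω, M.received S j (b + 1) ω n * star (M.received S j (b' + 1) ω n') *
        (M.effChan j g.1 g.2 (s + 1) ω n' * star (M.effChan j g.1 g.2 (s + 1) ω n)) ∂P =
      if n = n' then (S.lam j g.1 g.2 : ℂ) * S.Psi j b b' +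
        (S.lam j g.1 g.2 : ℂ) ^ 2 * S.X g.1 g.2 b b'
      else (S.lam j g.1 g.2 : ℂ) ^ 2 * ((S.symbols b g * phaseCorr S.delta s b) *
        (star (S.symbols b' g) * phaseCorr S.delta s b')) := by
  have := isProbabilityMeasure_phaseLaw hM j
  have hc := continuous_recv (N := N) S hBT
  have he := fun n : Fin N => continuous_effCoord (N := N) g n s
  have h := integral_recv_mul_star_of_chan_phase hM hBT j n n' b b'
    ((hasAllMoments_chan hM j g n').mul (hasAllMoments_chan hM j g n).star)
    ((hasAllMoments_phasor hM j n' s).mul (hasAllMoments_phasor hM j n s).star)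
  simp_rw [received_eq_recv hM hBT, effChan_eq_effCoord]
  rw [integral_base_upsBlock hM j (f := fun q => recv S hBT n b q * star (recv S hBT n' b' q) *
    (effCoord g n' s q * star (effCoord g n s q)))
    (((hc n b).mul (hc n' b').star).mul ((he n').mul (he n).star))]
  rw [integral_faded_fourth hM, integral_phasor_four hM] at h
  refine Eq.trans (integral_congr_ae (Filter.Eventually.of_forall fun q => ?_)) (h.trans ?_)
  · simp only [effCoord, scaled, star_mul']
    ring
  · by_cases hn : n = n'
    · subst hn
      simp only [if_true, and_true, phasor_mul_star]
      rw [integral_distVar_mul_chan hM, integral_chan_mul_star hM]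
      simp only [and_self, if_true, integral_const, probReal_univ, one_smul, mul_one]
      exact S.weighted_Psi_parts j g b b'
    · rw [if_neg hn, if_neg hn, if_neg hn, if_neg fun h => hn h.2]
      simp only [Fin.val_castLE]
      ring

lemma integral_received_upsVec (hM : IsHardwareUplink P T S M) (hBT : B ≤ T) (j : Fin L)
    (n n' : Fin N) (s : Fin T) (hs : B ≤ s) (b b' : Fin B) :
    ∫ ω, M.received S j (b + 1) ω n * star (M.received S j (b' + 1) ω n') *
        (M.upsVec j (s + 1) ω n' * star (M.upsVec j (s + 1) ω n)) ∂P =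
      if n = n' then S.kappa ^ 2 * ∑ g : Fin L × Fin K, (S.p g.1 g.2 : ℂ) *
        ((S.lam j g.1 g.2 : ℂ) * S.Psi j b b' + (S.lam j g.1 g.2 : ℂ) ^ 2 * S.X g.1 g.2 b b')
      else 0 := by
  have := isProbabilityMeasure_chan hM j
  have := isProbabilityMeasure_phaseLaw hM j
  have hc := continuous_recv (N := N) S hBT
  have hp := M.power_nonneg P s
  -- The channel use `s + 1` lies after the pilot phase, so its distortion is not part of the
  -- observation and only one of the two Wick pairings survives.
  have hne : ∀ (b : Fin B) (n m : Fin N), (Fin.castLE hBT b, n) ≠ (s, m) := by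
    intro b n m h
    have := congrArg (fun i => (i.1 : ℕ)) h
    simp at this
    omega
  have hcast : (Fin.castLE hBT b, n) = (Fin.castLE hBT b', n') ↔ b = b' ∧ n = n' := by
    simp [Prod.ext_iff, Fin.ext_iff]
  have hz := hasAllMoments_circGaussianPi_eval fun _ : Fin T × Fin N => (1 : ℝ≥0)
  have h := integral_recv_mul_star hM hBT j n n' b b'
    ((hasAllMoments_sqrt_distVar hM j S.kappa hp n').mul
      (hasAllMoments_sqrt_distVar hM j S.kappa hp n).star) (HasAllMoments.const 1)
    (gZ := fun z => z (s, n') * star (z (s, n))) ((hz _).mul (hz _).star)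
    (integral_circGaussianPi_third _ _ _ _) (integral_circGaussianPi_third_star _ _ _ _)
    (by
      rw [integral_circGaussianPi_fourth, integral_circGaussianPi_mul_star]
      simp only [hcast, hne, false_and, if_false, add_zero, NNReal.coe_one, Complex.ofReal_one,
        mul_one, ite_and])
  simp_rw [received_eq_recv hM hBT]
  change ∫ ω, _ * (M.upsBlock T j ω (s, n') * star (M.upsBlock T j ω (s, n))) ∂P = _
  rw [integral_base_upsBlock hM j (f := fun q => recv S hBT n b q * star (recv S hBT n' b' q) *
    (q.2 (s, n') * star (q.2 (s, n))))
    (((hc n b).mul (hc n' b').star).mul (by fun_prop))]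
  rw [integral_circGaussianPi_mul_star] at h
  refine Eq.trans (integral_congr_ae (Filter.Eventually.of_forall fun q => ?_)) (h.trans ?_)
  · simp only [scaled, star_mul', mul_one]
    ring
  · by_cases hn : n = n'
    · subst hn
      simp_rw [sqrt_distVar_mul_star hp, power_data hM s hs, mul_one]
      have h1 := integral_chan_distVar hM j S.kappa S.p n
        ((hasAllMoments_faded hM j (S.symbols b) n).mul
          (hasAllMoments_faded hM j (S.symbols b') n).star)
      have hd : HasAllMoments (fun c => ((distVar S.kappa (S.pilotPower b) c n : ℝ) : ℂ))
          (P.map (M.chan j)) := by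
        have h0 := hasAllMoments_sqrt_distVar hM j S.kappa (S.pilotPower_nonneg b) n
        have := h0.mul h0.star
        simp_rw [sqrt_distVar_mul_star (S.pilotPower_nonneg b)] at this
        exact this
      have h2 := integral_chan_distVar hM j S.kappa S.p n hd
      rw [h1, h2, integral_distVar hM, integral_phasor hM]
      simp_rw [integral_faded_fourth hM, integral_distVar_mul_chan hM, if_true,
        ← S.weighted_Psi_parts]
      simp only [and_true, integral_const, probReal_univ, one_smul, mul_one,
        NNReal.coe_one, Complex.ofReal_one, Fin.val_castLE]
      generalize (∑ a : Fin L × Fin K, (S.lam j a.1 a.2 : ℂ) *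
        (S.symbols b a * star (S.symbols b' a))) = A
      generalize (S.kappa : ℂ) ^ 2 * ∑ a : Fin L × Fin K,
        (S.pilotPower b a.1 a.2 : ℂ) * (S.lam j a.1 a.2 : ℂ) = V
      split_ifs with hb <;>
      · simp only [Finset.mul_sum, Finset.sum_mul, ← Finset.sum_add_distrib, add_zero]
        refine Finset.sum_congr rfl fun g _ => ?_
        ring
    · have : ¬((s, n') = (s, n)) := fun h => hn (Prod.ext_iff.1 h).2.symm
      simp [hn, this]

end ObservationMoments

/-! ### Positive definiteness -/

section PosDef

open scoped ComplexOrder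

/-- The increments of `k ↦ exp(δ k)`, started at `1`. -/
noncomputable def expIncrement (δ : ℝ) (k : ℕ) : ℝ :=
  if k = 0 then 1 else Real.exp (δ * k) - Real.exp (δ * (k - 1))

lemma expIncrement_nonneg {δ : ℝ} (hδ : 0 ≤ δ) (k : ℕ) : 0 ≤ expIncrement δ k := by
  unfold expIncrement
  split_ifs
  · exact zero_le_one
  · rw [sub_nonneg, Real.exp_le_exp]
    nlinarith

lemma sum_expIncrement (δ : ℝ) (m : ℕ) :
    ∑ k ∈ Finset.range (m + 1), expIncrement δ k = Real.exp (δ * m) := by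
  induction m with
  | zero => simp [expIncrement]
  | succ m ih =>
    rw [Finset.sum_range_succ, ih, expIncrement, if_neg (by omega)]
    push_cast
    ring_nf

/-- The correlation kernel `exp(-δ|i-j|/2)` as a nonnegative combination of rank-one kernels. -/
lemma phaseCorr_eq_sum {B : ℕ} (δ : ℝ≥0) (i j : Fin B) :
    phaseCorr δ i j = ∑ k : Fin B, (expIncrement δ k : ℂ) *
      ((if (k : ℕ) ≤ i then (Real.exp (-((δ : ℝ) / 2) * i) : ℂ) else 0) *
        (if (k : ℕ) ≤ j then (Real.exp (-((δ : ℝ) / 2) * j) : ℂ) else 0)) := by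
  wlog hij : (j : ℕ) ≤ i generalizing i j
  · rw [phaseCorr_comm, this j i (by omega)]
    exact Finset.sum_congr rfl fun k _ => by ring
  have hsum : ∑ k : Fin B, (expIncrement δ k : ℂ) *
      ((if (k : ℕ) ≤ i then (Real.exp (-((δ : ℝ) / 2) * i) : ℂ) else 0) *
        (if (k : ℕ) ≤ j then (Real.exp (-((δ : ℝ) / 2) * j) : ℂ) else 0)) =
      ∑ k ∈ Finset.range B, if k < (j : ℕ) + 1 then (expIncrement δ k : ℂ) *
        ((Real.exp (-((δ : ℝ) / 2) * i) : ℂ) * (Real.exp (-((δ : ℝ) / 2) * j) : ℂ)) else 0 := by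
    rw [← Fin.sum_univ_eq_sum_range]
    refine Finset.sum_congr rfl fun k _ => ?_
    by_cases hk : (k : ℕ) ≤ j
    · rw [if_pos (hk.trans hij), if_pos hk, if_pos (by omega)]
    · rw [if_neg hk, mul_zero, mul_zero, if_neg (by omega)]
  rw [hsum, ← Finset.sum_filter]
  have hfilter : (Finset.range B).filter (fun k => k < (j : ℕ) + 1) =
      Finset.range ((j : ℕ) + 1) := by
    ext k
    simp only [Finset.mem_filter, Finset.mem_range]
    omega
  rw [hfilter, ← Finset.sum_mul, ← Complex.ofReal_sum, sum_expIncrement, phaseCorr,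
    ← Complex.ofReal_mul, ← Complex.ofReal_mul, ← Real.exp_add, ← Real.exp_add]
  have hij' : ((j : ℕ) : ℝ) ≤ i := by exact_mod_cast hij
  rw [abs_of_nonneg (by linarith)]
  congr 2
  ring

lemma posSemidef_phaseCorr (δ : ℝ≥0) (B : ℕ) :
    (Matrix.of fun i j : Fin B => phaseCorr δ i j).PosSemidef := by
  have h : (Matrix.of fun i j : Fin B => phaseCorr δ i j) =
      ∑ k : Fin B, (expIncrement δ k : ℂ) • Matrix.vecMulVec
        (fun i : Fin B => if (k : ℕ) ≤ i then (Real.exp (-((δ : ℝ) / 2) * i) : ℂ) else 0)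
        (star fun i : Fin B =>
          if (k : ℕ) ≤ i then (Real.exp (-((δ : ℝ) / 2) * i) : ℂ) else 0) := by
    ext i j
    rw [Matrix.of_apply, phaseCorr_eq_sum, Matrix.sum_apply]
    refine Finset.sum_congr rfl fun k _ => ?_
    simp only [Matrix.smul_apply, Matrix.vecMulVec_apply, Pi.star_apply, smul_eq_mul]
    congr 2
    split_ifs
    · exact (Complex.conj_ofReal _).symm
    · simp
  rw [h]
  refine Matrix.posSemidef_sum _ fun k _ => (Matrix.posSemidef_vecMulVec_self_star _).smul ?_
  exact_mod_cast expIncrement_nonneg δ.2 k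

namespace UplinkParams

variable {L K B : ℕ} (S : UplinkParams L K B)

lemma posSemidef_X (l : Fin L) (m : Fin K) : (S.X l m).PosSemidef := by
  have h : S.X l m = Matrix.diagonal (S.pilot l m) *
      (Matrix.of fun i j : Fin B => phaseCorr S.delta i j) * (Matrix.diagonal (S.pilot l m))ᴴ +
      Matrix.diagonal fun b => (S.kappa : ℂ) ^ 2 * (S.pilotPower b l m : ℂ) := by
    ext b b'
    rw [X_apply, Matrix.add_apply, Matrix.diagonal_conjTranspose, Matrix.mul_diagonal,
      Matrix.diagonal_mul, Matrix.diagonal_apply, Matrix.of_apply, Pi.star_apply]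
    ring
  rw [h]
  refine ((posSemidef_phaseCorr S.delta B).mul_mul_conjTranspose_same _).add
    (Matrix.PosSemidef.diagonal fun b => ?_)
  rw [Pi.zero_apply, ← Complex.ofReal_pow, ← Complex.ofReal_mul]
  exact Complex.zero_le_real.2 (mul_nonneg (sq_nonneg _) (S.pilotPower_nonneg b l m))

/-- `Ψ` is positive definite: the `X_{lm}` are positive semidefinite and the noise variance is
positive. -/
lemma posDef_Psi (j : Fin L) : (S.Psi j).PosDef := by
  refine Matrix.PosDef.posSemidef_add
    (Matrix.posSemidef_sum _ fun l _ => Matrix.posSemidef_sum _ fun m _ =>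
      (S.posSemidef_X l m).smul ?_) (Matrix.PosDef.one.smul ?_)
  · exact_mod_cast (S.lam_pos j l m).le
  · have := S.one_le_xi
    have := S.sigma_pos
    exact_mod_cast (by positivity : 0 < S.sigma ^ 2 * S.xi)

lemma isUnit_det_Psi (j : Fin L) : IsUnit (S.Psi j).det :=
  (Matrix.isUnit_iff_isUnit_det _).1 (S.posDef_Psi j).isUnit

lemma conjTranspose_D (t : ℕ) : (S.D t)ᴴ = S.D t := by
  rw [D, Matrix.diagonal_conjTranspose]
  congr 1
  funext i
  exact Complex.conj_ofReal _

/-! ### The filter coefficients -/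

lemma filterRow_apply (j l : Fin L) (k : Fin K) (t : ℕ) (b : Fin B) :
    S.filterRow j l k t () b =
      (S.lam j l k : ℂ) * (star (S.pilot l k) ᵥ* (S.D t * (S.Psi j)⁻¹)) b := by
  rw [filterRow, Matrix.smul_apply, Matrix.mul_assoc]
  rfl

lemma star_filterRow_apply (j l : Fin L) (k : Fin K) (t : ℕ) (b : Fin B) :
    star (S.filterRow j l k t () b) =
      (S.lam j l k : ℂ) * (((S.Psi j)⁻¹ * (S.D t)ᴴ) *ᵥ S.pilot l k) b := by
  have h := congrFun (Matrix.star_vecMul (S.D t * (S.Psi j)⁻¹) (star (S.pilot l k))) b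
  rw [Matrix.conjTranspose_mul, (S.posDef_Psi j).inv.1.eq, star_star, Pi.star_apply] at h
  rw [filterRow_apply, star_mul', h]
  congr 1
  exact Complex.conj_ofReal _

/-- The quadratic form of a matrix at the filter coefficients. -/
lemma sum_filterRow_mul_star (j l : Fin L) (k : Fin K) (t : ℕ) (A : Matrix (Fin B) (Fin B) ℂ) :
    ∑ b, ∑ b', S.filterRow j l k t () b * star (S.filterRow j l k t () b') * A b b' =
      (S.lam j l k : ℂ) ^ 2 * (star (S.pilot l k) ⬝ᵥ
        (S.D t * (S.Psi j)⁻¹ * A * (S.Psi j)⁻¹ * (S.D t)ᴴ) *ᵥ S.pilot l k) := by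
  have h : (star (S.pilot l k) ⬝ᵥ
      (S.D t * (S.Psi j)⁻¹ * A * (S.Psi j)⁻¹ * (S.D t)ᴴ) *ᵥ S.pilot l k) =
      (star (S.pilot l k) ᵥ* (S.D t * (S.Psi j)⁻¹)) ⬝ᵥ
        (A *ᵥ (((S.Psi j)⁻¹ * (S.D t)ᴴ) *ᵥ S.pilot l k)) := by
    rw [← Matrix.dotProduct_mulVec, Matrix.mulVec_mulVec, Matrix.mulVec_mulVec]
    simp only [Matrix.mul_assoc]
  rw [h]
  simp only [dotProduct, Matrix.mulVec, star_filterRow_apply, Finset.mul_sum]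
  refine Finset.sum_congr rfl fun b _ => Finset.sum_congr rfl fun b' _ => ?_
  rw [filterRow_apply]
  simp only [Finset.sum_mul]
  refine Finset.sum_congr rfl fun b'' _ => ?_
  ring

lemma sum_filterRow_Psi (j l : Fin L) (k : Fin K) (t : ℕ) :
    ∑ b, ∑ b', S.filterRow j l k t () b * star (S.filterRow j l k t () b') * S.Psi j b b' =
      (S.lam j l k : ℂ) ^ 2 * (star (S.pilot l k) ⬝ᵥ
        (S.D t * (S.Psi j)⁻¹ * (S.D t)ᴴ) *ᵥ S.pilot l k) := by
  rw [sum_filterRow_mul_star, Matrix.mul_assoc (S.D t) (S.Psi j)⁻¹ (S.Psi j),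
    Matrix.nonsing_inv_mul _ (S.isUnit_det_Psi j), Matrix.mul_one]

lemma sum_filterRow_mul_symbols (j l : Fin L) (k : Fin K) (s : ℕ) (hs : B ≤ s + 1)
    (g : Fin L × Fin K) :
    ∑ b, S.filterRow j l k (s + 1) () b * (S.symbols b g * phaseCorr S.delta s b) =
      (S.lam j l k : ℂ) * (star (S.pilot l k) ⬝ᵥ
        (S.D (s + 1) * (S.Psi j)⁻¹ * (S.D (s + 1))ᴴ) *ᵥ S.pilot g.1 g.2) := by
  rw [← Matrix.mulVec_mulVec, Matrix.dotProduct_mulVec, conjTranspose_D]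
  simp only [filterRow_apply]
  rw [D_apply_eq_phaseCorr S s hs, dotProduct, Finset.mul_sum]
  refine Finset.sum_congr rfl fun b _ => ?_
  rw [Matrix.mulVec_diagonal, symbols]
  ring

/-- The quadratic form of `D Ψ⁻¹ Dᴴ` is real. -/
lemma star_quadForm (j l : Fin L) (k : Fin K) (t : ℕ) :
    star (star (S.pilot l k) ⬝ᵥ (S.D t * (S.Psi j)⁻¹ * (S.D t)ᴴ) *ᵥ S.pilot l k) =
      star (S.pilot l k) ⬝ᵥ (S.D t * (S.Psi j)⁻¹ * (S.D t)ᴴ) *ᵥ S.pilot l k := by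
  have h := ((S.posDef_Psi j).inv.posSemidef.mul_mul_conjTranspose_same
    (S.D t)).dotProduct_mulVec_nonneg (S.pilot l k)
  exact (IsSelfAdjoint.of_nonneg h).star_eq

end UplinkParams

end PosDef

/-! ### Moments of linear filters -/

section Filter

variable {N B : ℕ} {Ω : Type*} [MeasurableSpace Ω] {P : Measure Ω}

lemma hasAllMoments_filter {y : Fin N → Fin B → Ω → ℂ} (hy : ∀ n b, HasAllMoments (y n b) P)
    (a : Fin B → ℂ) (n : Fin N) : HasAllMoments (fun ω => ∑ b, a b * y n b ω) P :=
  HasAllMoments.sum fun b _ => (hy n b).const_mul (a b)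

lemma integral_norm_sq_filter {y : Fin N → Fin B → Ω → ℂ} (hy : ∀ n b, HasAllMoments (y n b) P)
    (a : Fin B → ℂ) :
    ((∫ ω, ∑ n, ‖∑ b, a b * y n b ω‖ ^ 2 ∂P : ℝ) : ℂ) =
      ∑ n, ∑ b, ∑ b', a b * star (a b') * ∫ ω, y n b ω * star (y n b' ω) ∂P := by
  have e : ∀ ω, ((∑ n, ‖∑ b, a b * y n b ω‖ ^ 2 : ℝ) : ℂ) =
      ∑ n, ∑ b, ∑ b', a b * star (a b') * (y n b ω * star (y n b' ω)) := by
    intro ω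
    push_cast
    refine Finset.sum_congr rfl fun n _ => ?_
    rw [← Complex.mul_conj', ← Complex.star_def, star_sum, Finset.sum_mul_sum]
    refine Finset.sum_congr rfl fun b _ => Finset.sum_congr rfl fun b' _ => ?_
    rw [star_mul']; ring
  have hint : ∀ n b b', Integrable (fun ω => a b * star (a b') * (y n b ω * star (y n b' ω))) P :=
    fun n b b' => (((hy n b).mul (hy n b').star).const_mul _).integrable
  rw [← integral_complex_ofReal]
  simp_rw [e]
  rw [integral_finsetSum _ fun n _ => integrable_finsetSum _ fun b _ =>
    integrable_finsetSum _ fun b' _ => hint n b b']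
  refine Finset.sum_congr rfl fun n _ => ?_
  rw [integral_finsetSum _ fun b _ => integrable_finsetSum _ fun b' _ => hint n b b']
  refine Finset.sum_congr rfl fun b _ => ?_
  rw [integral_finsetSum _ fun b' _ => hint n b b']
  simp_rw [integral_const_mul]

/-- The second moment of `vᴴ u` for a filter `v_n = ∑ a_b y_n(b)`, expanded into joint moments of
the observation `y` and the vector `u`. -/
lemma integral_norm_sq_filter_dotProduct {y : Fin N → Fin B → Ω → ℂ} {u : Fin N → Ω → ℂ}
    (hy : ∀ n b, HasAllMoments (y n b) P) (hu : ∀ n, HasAllMoments (u n) P) (a : Fin B → ℂ) :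
    ((∫ ω, ‖∑ n, star (∑ b, a b * y n b ω) * u n ω‖ ^ 2 ∂P : ℝ) : ℂ) =
      ∑ n, ∑ n', ∑ b, ∑ b', a b * star (a b') *
        ∫ ω, y n b ω * star (y n' b' ω) * (u n' ω * star (u n ω)) ∂P := by
  have e : ∀ ω, ((‖∑ n, star (∑ b, a b * y n b ω) * u n ω‖ ^ 2 : ℝ) : ℂ) =
      ∑ n, ∑ n', ∑ b, ∑ b', a b * star (a b') *
        (y n b ω * star (y n' b' ω) * (u n' ω * star (u n ω))) := by
    intro ω
    push_cast
    rw [← Complex.conj_mul', ← Complex.star_def, star_sum, Finset.sum_mul_sum]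
    refine Finset.sum_congr rfl fun n _ => Finset.sum_congr rfl fun n' _ => ?_
    rw [star_mul', star_star, star_sum, mul_mul_mul_comm, Finset.sum_mul_sum, Finset.sum_mul]
    refine Finset.sum_congr rfl fun b _ => ?_
    rw [Finset.sum_mul]
    refine Finset.sum_congr rfl fun b' _ => ?_
    rw [star_mul']; ring
  have hint : ∀ n n' b b', Integrable (fun ω => a b * star (a b') *
      (y n b ω * star (y n' b' ω) * (u n' ω * star (u n ω)))) P :=
    fun n n' b b' => ((((hy n b).mul (hy n' b').star).mul
      ((hu n').mul (hu n).star)).const_mul _).integrable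
  rw [← integral_complex_ofReal]
  simp_rw [e]
  rw [integral_finsetSum _ fun n _ => integrable_finsetSum _ fun n' _ =>
    integrable_finsetSum _ fun b _ => integrable_finsetSum _ fun b' _ => hint n n' b b']
  refine Finset.sum_congr rfl fun n _ => ?_
  rw [integral_finsetSum _ fun n' _ =>
    integrable_finsetSum _ fun b _ => integrable_finsetSum _ fun b' _ => hint n n' b b']
  refine Finset.sum_congr rfl fun n' _ => ?_
  rw [integral_finsetSum _ fun b _ => integrable_finsetSum _ fun b' _ => hint n n' b b']
  refine Finset.sum_congr rfl fun b _ => ?_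
  rw [integral_finsetSum _ fun b' _ => hint n n' b b']
  simp_rw [integral_const_mul]

/-- Splitting a double sum over antennas into the equal and the distinct pairs. -/
lemma sum_filter_ite_eq (N : ℕ) (a : Fin B → ℂ) (E F : Fin B → Fin B → ℂ) :
    ∑ n : Fin N, ∑ n' : Fin N, ∑ b, ∑ b', a b * star (a b') *
        (if n = n' then E b b' else F b b') =
      N * ∑ b, ∑ b', a b * star (a b') * E b b' +
        N * ((N : ℂ) - 1) * ∑ b, ∑ b', a b * star (a b') * F b b' := by
  set c := ∑ b, ∑ b', a b * star (a b') * E b b'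
  set d := ∑ b, ∑ b', a b * star (a b') * F b b'
  have h : ∀ n n' : Fin N, (∑ b, ∑ b', a b * star (a b') *
      (if n = n' then E b b' else F b b')) = d + if n = n' then c - d else 0 := by
    intro n n'
    split_ifs
    · exact (add_sub_cancel d c).symm
    · exact (add_zero d).symm
  simp_rw [h, Finset.sum_add_distrib]
  simp
  ring

end Filter

/-! ### The estimator and the filter output -/

lemma kronecker_mulVec_psi {L K N B : ℕ} {Ω : Type*} (S : UplinkParams L K B)
    (M : UplinkSignals L K N Ω) (R : Matrix Unit (Fin B) ℂ) (j : Fin L) (ω : Ω) (n : Fin N) :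
    ((R ⊗ₖ (1 : Matrix (Fin N) (Fin N) ℂ)) *ᵥ M.psi S j ω) ((), n) =
      ∑ b, R () b * M.received S j (b + 1) ω n := by
  rw [Matrix.mulVec, dotProduct, Fintype.sum_prod_type]
  refine Finset.sum_congr rfl fun b _ => ?_
  simp [Matrix.one_apply, psi]

section Estimator

variable {L K N B T : ℕ} {Ω : Type*} [MeasurableSpace Ω] {P : Measure Ω}
    [IsProbabilityMeasure P] {S : UplinkParams L K B} {M : UplinkSignals L K N Ω}

lemma crossMoment_psi (hM : IsHardwareUplink P T S M) (hBT : B ≤ T) (j : Fin L) :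
    crossMoment P (M.psi S j) (M.psi S j) = S.Psi j ⊗ₖ (1 : Matrix (Fin N) (Fin N) ℂ) := by
  ext ⟨b, n⟩ ⟨b', n'⟩
  rw [crossMoment, Matrix.of_apply, Matrix.kronecker_apply, Matrix.one_apply]
  simp only [psi]
  rw [integral_received_mul_star hM hBT, mul_ite, mul_one, mul_zero]

lemma isUnit_det_crossMoment_psi (hM : IsHardwareUplink P T S M) (hBT : B ≤ T) (j : Fin L) :
    IsUnit (crossMoment P (M.psi S j) (M.psi S j)).det := by
  rw [crossMoment_psi hM hBT, Matrix.det_kronecker, Matrix.det_one, one_pow, mul_one]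
  exact (S.isUnit_det_Psi j).pow _

lemma crossMoment_effChan_psi (hM : IsHardwareUplink P T S M) (hBT : B ≤ T) (j : Fin L)
    (g : Fin L × Fin K) (s : Fin T) (hs : B ≤ s + 1) :
    crossMoment P (M.effChan j g.1 g.2 (s + 1)) (M.psi S j) =
      (((S.lam j g.1 g.2 : ℂ) • (Matrix.replicateRow Unit (star (S.pilot g.1 g.2)) *
        S.D (s + 1))) ⊗ₖ (1 : Matrix (Fin N) (Fin N) ℂ)).submatrix (fun n => ((), n)) id := by
  ext n ⟨b', n'⟩
  rw [crossMoment, Matrix.of_apply, Matrix.submatrix_apply, id, Matrix.kronecker_apply,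
    Matrix.one_apply]
  simp only [psi]
  rw [integral_effChan_mul_star hM hBT, mul_ite, mul_one, mul_zero, Matrix.smul_apply,
    UplinkParams.D_apply_eq_phaseCorr S s hs, Matrix.mul_diagonal]
  rfl

lemma hhat_eq_filterRow (hM : IsHardwareUplink P T S M) (hBT : B ≤ T) (j : Fin L)
    (g : Fin L × Fin K) (s : Fin T) (hs : B ≤ s + 1) (ω : Ω) (n : Fin N) :
    M.hhat P S j g.1 g.2 (s + 1) ω n =
      ((S.filterRow j g.1 g.2 (s + 1) ⊗ₖ (1 : Matrix (Fin N) (Fin N) ℂ)) *ᵥ M.psi S j ω)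
        ((), n) := by
  rw [hhat, lmmse, crossMoment_psi hM hBT, crossMoment_effChan_psi hM hBT j g s hs,
    Matrix.inv_kronecker, inv_one, ← Matrix.submatrix_id_id
      ((S.Psi j)⁻¹ ⊗ₖ (1 : Matrix (Fin N) (Fin N) ℂ)),
    ← Matrix.submatrix_mul _ _ _ _ _ Function.bijective_id, ← Matrix.mul_kronecker_mul,
    mul_one, Matrix.smul_mul]
  rfl

lemma mrc_apply (hM : IsHardwareUplink P T S M) (hBT : B ≤ T) (j : Fin L) (k : Fin K)
    (s : Fin T) (hs : B ≤ s + 1) (ω : Ω) (n : Fin N) :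
    M.mrc P S j k (s + 1) ω n =
      ∑ b, S.filterRow j j k (s + 1) () b * M.received S j (b + 1) ω n := by
  rw [mrc, hhat_eq_filterRow hM hBT j (j, k) s hs, kronecker_mulVec_psi]

lemma hasAllMoments_mrc (hM : IsHardwareUplink P T S M) (hBT : B ≤ T) (j : Fin L) (k : Fin K)
    (s : Fin T) (hs : B ≤ s + 1) (n : Fin N) :
    HasAllMoments (fun ω => M.mrc P S j k (s + 1) ω n) P := by
  simp_rw [mrc_apply hM hBT j k s hs]
  exact hasAllMoments_filter (fun n b => hasAllMoments_received hM hBT j n b) _ n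

lemma integrable_norm_sq_mrc (hM : IsHardwareUplink P T S M) (hBT : B ≤ T) (j : Fin L)
    (k : Fin K) (s : Fin T) (hs : B ≤ s + 1) :
    Integrable (fun ω => ‖WithLp.toLp 2 (M.mrc P S j k (s + 1) ω)‖ ^ 2) P := by
  simp_rw [EuclideanSpace.norm_sq_eq]
  exact integrable_finsetSum _ fun n _ => (hasAllMoments_mrc hM hBT j k s hs n).normSq

lemma hasAllMoments_star_mrc_dotProduct (hM : IsHardwareUplink P T S M) (hBT : B ≤ T)
    (j : Fin L) (k : Fin K) (s : Fin T) (hs : B ≤ s + 1) {u : Ω → Fin N → ℂ}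
    (hu : ∀ n, HasAllMoments (fun ω => u ω n) P) :
    HasAllMoments (fun ω => star (M.mrc P S j k (s + 1) ω) ⬝ᵥ u ω) P :=
  HasAllMoments.sum fun n _ => (hasAllMoments_mrc hM hBT j k s hs n).star.mul (hu n)

lemma integral_norm_sq_mrc (hM : IsHardwareUplink P T S M) (hBT : B ≤ T) (j : Fin L)
    (k : Fin K) (s : Fin T) (hs : B ≤ s + 1) :
    ((∫ ω, ‖WithLp.toLp 2 (M.mrc P S j k (s + 1) ω)‖ ^ 2 ∂P : ℝ) : ℂ) =
      N * (S.lam j j k : ℂ) ^ 2 * (star (S.pilot j k) ⬝ᵥ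
        (S.D (s + 1) * (S.Psi j)⁻¹ * (S.D (s + 1))ᴴ) *ᵥ S.pilot j k) := by
  simp_rw [EuclideanSpace.norm_sq_eq, mrc_apply hM hBT j k s hs]
  rw [integral_norm_sq_filter (fun n b => hasAllMoments_received hM hBT j n b)]
  simp_rw [integral_received_mul_star hM hBT, if_true, UplinkParams.sum_filterRow_Psi]
  simp
  ring

lemma integral_star_mrc_dotProduct_effChan (hM : IsHardwareUplink P T S M) (hBT : B ≤ T)
    (j : Fin L) (k : Fin K) (s : Fin T) (hs : B ≤ s + 1) :
    ∫ ω, star (M.mrc P S j k (s + 1) ω) ⬝ᵥ M.effChan j j k (s + 1) ω ∂P =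
      N * (S.lam j j k : ℂ) ^ 2 * (star (S.pilot j k) ⬝ᵥ
        (S.D (s + 1) * (S.Psi j)⁻¹ * (S.D (s + 1))ᴴ) *ᵥ S.pilot j k) := by
  have e : ∀ ω, star (M.mrc P S j k (s + 1) ω) ⬝ᵥ M.effChan j j k (s + 1) ω =
      ∑ n, ∑ b, star (S.filterRow j j k (s + 1) () b) *
        (M.effChan j j k (s + 1) ω n * star (M.received S j (b + 1) ω n)) := by
    intro ω
    refine Finset.sum_congr rfl fun n _ => ?_
    rw [Pi.star_apply, mrc_apply hM hBT j k s hs, star_sum, Finset.sum_mul]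
    refine Finset.sum_congr rfl fun b _ => ?_
    rw [star_mul']; ring
  have hint : ∀ n b, Integrable (fun ω => star (S.filterRow j j k (s + 1) () b) *
        (M.effChan j j k (s + 1) ω n * star (M.received S j (b + 1) ω n))) P := fun n b =>
    (((hasAllMoments_effChan hM j (j, k) n s).mul
      (hasAllMoments_received hM hBT j n b).star).const_mul _).integrable
  simp_rw [e]
  rw [integral_finsetSum _ fun n _ => integrable_finsetSum _ fun b _ => hint n b]
  simp_rw [integral_finsetSum _ fun b _ => hint _ b, integral_const_mul]
  have h1 := fun n b => integral_effChan_mul_star hM hBT j (j, k) n n s b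
  simp only [if_true] at h1
  simp_rw [h1]
  have h2 := congrArg star (S.sum_filterRow_mul_symbols j j k s hs (j, k))
  rw [star_sum, star_mul', S.star_quadForm, Complex.star_def, Complex.conj_ofReal] at h2
  rw [Finset.sum_const, Finset.card_univ, Fintype.card_fin, nsmul_eq_mul, pow_two, mul_assoc,
    mul_assoc, ← h2, Finset.mul_sum, Finset.mul_sum, Finset.mul_sum]
  refine Finset.sum_congr rfl fun b _ => ?_
  rw [← Complex.star_def, star_mul', star_mul', star_phaseCorr]
  ring

lemma integral_norm_sq_star_mrc_dotProduct_effChan (hM : IsHardwareUplink P T S M) (hBT : B ≤ T)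
    (j : Fin L) (k : Fin K) (s : Fin T) (hs : B ≤ s + 1) (g : Fin L × Fin K) :
    ((∫ ω, ‖star (M.mrc P S j k (s + 1) ω) ⬝ᵥ M.effChan j g.1 g.2 (s + 1) ω‖ ^ 2 ∂P : ℝ) : ℂ) =
      (S.lam j g.1 g.2 : ℂ) * (N * (S.lam j j k : ℂ) ^ 2 * (star (S.pilot j k) ⬝ᵥ
        (S.D (s + 1) * (S.Psi j)⁻¹ * (S.D (s + 1))ᴴ) *ᵥ S.pilot j k)) +
      N * (S.lam j j k : ℂ) ^ 2 * (S.lam j g.1 g.2 : ℂ) ^ 2 * (star (S.pilot j k) ⬝ᵥ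
        (S.D (s + 1) * (S.Psi j)⁻¹ * S.X g.1 g.2 * (S.Psi j)⁻¹ * (S.D (s + 1))ᴴ) *ᵥ
          S.pilot j k) +
      N * ((N : ℂ) - 1) * (S.lam j j k : ℂ) ^ 2 * (S.lam j g.1 g.2 : ℂ) ^ 2 *
        ((‖star (S.pilot j k) ⬝ᵥ (S.D (s + 1) * (S.Psi j)⁻¹ * (S.D (s + 1))ᴴ) *ᵥ
          S.pilot g.1 g.2‖ ^ 2 : ℝ) : ℂ) := by
  have h := integral_norm_sq_filter_dotProduct (u := fun n ω => M.effChan j g.1 g.2 (s + 1) ω n)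
    (fun n b => hasAllMoments_received hM hBT j n b)
    (fun n => hasAllMoments_effChan hM j g n s) (fun b => S.filterRow j j k (s + 1) () b)
  simp_rw [← mrc_apply hM hBT j k s hs, integral_received_effChan hM hBT] at h
  refine Eq.trans (by rfl) (h.trans ?_)
  set q := star (S.pilot j k) ⬝ᵥ (S.D (s + 1) * (S.Psi j)⁻¹ * (S.D (s + 1))ᴴ) *ᵥ
    S.pilot g.1 g.2 with hq
  have hsame : ∑ b, ∑ b', S.filterRow j j k (s + 1) () b * star (S.filterRow j j k (s + 1) () b') *
      ((S.lam j g.1 g.2 : ℂ) * S.Psi j b b' + (S.lam j g.1 g.2 : ℂ) ^ 2 * S.X g.1 g.2 b b') =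
      (S.lam j g.1 g.2 : ℂ) * ((S.lam j j k : ℂ) ^ 2 * (star (S.pilot j k) ⬝ᵥ
        (S.D (s + 1) * (S.Psi j)⁻¹ * (S.D (s + 1))ᴴ) *ᵥ S.pilot j k)) +
      (S.lam j g.1 g.2 : ℂ) ^ 2 * ((S.lam j j k : ℂ) ^ 2 * (star (S.pilot j k) ⬝ᵥ
        (S.D (s + 1) * (S.Psi j)⁻¹ * S.X g.1 g.2 * (S.Psi j)⁻¹ * (S.D (s + 1))ᴴ) *ᵥ
          S.pilot j k)) := by
    rw [← UplinkParams.sum_filterRow_Psi, ← UplinkParams.sum_filterRow_mul_star]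
    simp only [Finset.mul_sum, ← Finset.sum_add_distrib]
    exact Finset.sum_congr rfl fun b _ => Finset.sum_congr rfl fun b' _ => by ring
  have hdiff : ∑ b, ∑ b', S.filterRow j j k (s + 1) () b * star (S.filterRow j j k (s + 1) () b') *
      ((S.lam j g.1 g.2 : ℂ) ^ 2 * ((S.symbols b g * phaseCorr S.delta s b) *
        (star (S.symbols b' g) * phaseCorr S.delta s b'))) =
      (S.lam j g.1 g.2 : ℂ) ^ 2 * ((S.lam j j k : ℂ) ^ 2 * ((‖q‖ ^ 2 : ℝ) : ℂ)) := by
    have h1 := S.sum_filterRow_mul_symbols j j k s hs g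
    have h2 := congrArg star h1
    rw [star_mul', Complex.star_def, Complex.conj_ofReal, ← Complex.star_def] at h2
    have h3 : ((‖q‖ ^ 2 : ℝ) : ℂ) = q * star q := by
      rw [Complex.star_def, Complex.mul_conj']; push_cast; rfl
    have h4 : (S.lam j j k : ℂ) ^ 2 * (q * star q) =
      ((S.lam j j k : ℂ) * q) * ((S.lam j j k : ℂ) * star q) := by ring
    rw [h3, h4, ← h1, ← h2, star_sum, Finset.sum_mul_sum, Finset.mul_sum]
    refine Finset.sum_congr rfl fun b _ => ?_
    rw [Finset.mul_sum]
    refine Finset.sum_congr rfl fun b' _ => ?_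
    rw [star_mul', star_mul', star_phaseCorr]
    ring
  refine (sum_filter_ite_eq N _ _ _).trans ?_
  rw [hsame, hdiff]
  ring

lemma integral_norm_sq_star_mrc_dotProduct_upsVec (hM : IsHardwareUplink P T S M) (hBT : B ≤ T)
    (j : Fin L) (k : Fin K) (s : Fin T) (hs : B ≤ s) :
    ((∫ ω, ‖star (M.mrc P S j k (s + 1) ω) ⬝ᵥ M.upsVec j (s + 1) ω‖ ^ 2 ∂P : ℝ) : ℂ) =
      (S.kappa : ℂ) ^ 2 * ∑ l, ∑ m, (S.p l m : ℂ) * (S.lam j l m : ℂ) *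
        (N * (S.lam j j k : ℂ) ^ 2 * (star (S.pilot j k) ⬝ᵥ
          (S.D (s + 1) * (S.Psi j)⁻¹ * (S.D (s + 1))ᴴ) *ᵥ S.pilot j k)) +
      (S.kappa : ℂ) ^ 2 * ∑ l, ∑ m, (S.p l m : ℂ) *
        (N * (S.lam j j k : ℂ) ^ 2 * (S.lam j l m : ℂ) ^ 2 * (star (S.pilot j k) ⬝ᵥ
          (S.D (s + 1) * (S.Psi j)⁻¹ * S.X l m * (S.Psi j)⁻¹ * (S.D (s + 1))ᴴ) *ᵥ
            S.pilot j k)) := by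
  have h := integral_norm_sq_filter_dotProduct (u := fun n ω => M.upsVec j (s + 1) ω n)
    (fun n b => hasAllMoments_received hM hBT j n b)
    (fun n => hasAllMoments_upsVec hM j n s) (fun b => S.filterRow j j k (s + 1) () b)
  simp_rw [← mrc_apply hM hBT j k s (by omega), integral_received_upsVec hM hBT j _ _ s hs] at h
  refine Eq.trans (by rfl) (h.trans ?_)
  have hsame : ∑ b, ∑ b', S.filterRow j j k (s + 1) () b * star (S.filterRow j j k (s + 1) () b') *
      ((S.kappa : ℂ) ^ 2 * ∑ g : Fin L × Fin K, (S.p g.1 g.2 : ℂ) *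
        ((S.lam j g.1 g.2 : ℂ) * S.Psi j b b' + (S.lam j g.1 g.2 : ℂ) ^ 2 * S.X g.1 g.2 b b')) =
      (S.kappa : ℂ) ^ 2 * ∑ g : Fin L × Fin K, (S.p g.1 g.2 : ℂ) *
        ((S.lam j g.1 g.2 : ℂ) * ((S.lam j j k : ℂ) ^ 2 * (star (S.pilot j k) ⬝ᵥ
          (S.D (s + 1) * (S.Psi j)⁻¹ * (S.D (s + 1))ᴴ) *ᵥ S.pilot j k)) +
        (S.lam j g.1 g.2 : ℂ) ^ 2 * ((S.lam j j k : ℂ) ^ 2 * (star (S.pilot j k) ⬝ᵥ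
          (S.D (s + 1) * (S.Psi j)⁻¹ * S.X g.1 g.2 * (S.Psi j)⁻¹ * (S.D (s + 1))ᴴ) *ᵥ
            S.pilot j k))) := by
    simp_rw [← UplinkParams.sum_filterRow_Psi, ← UplinkParams.sum_filterRow_mul_star]
    simp only [Finset.mul_sum, ← Finset.sum_add_distrib]
    conv_rhs => rw [Finset.sum_comm]
    refine Finset.sum_congr rfl fun b _ => ?_
    conv_rhs => rw [Finset.sum_comm]
    exact Finset.sum_congr rfl fun b' _ => Finset.sum_congr rfl fun g _ => by ring
  refine (sum_filter_ite_eq N _ _ fun _ _ => 0).trans ?_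
  rw [hsame]
  simp only [mul_zero, Finset.sum_const_zero, add_zero, Fintype.sum_prod_type]
  simp only [Finset.mul_sum, ← Finset.sum_add_distrib]
  exact Finset.sum_congr rfl fun l _ => Finset.sum_congr rfl fun m _ => by ring

end Estimator

theorem theorem2 {L K N B T : ℕ} {Ω : Type*} [MeasurableSpace Ω] (P : Measure Ω)
    [IsProbabilityMeasure P] (S : UplinkParams L K B) (M : UplinkSignals L K N Ω)
    (hM : IsHardwareUplink P T S M) (j : Fin L) (k : Fin K) (t : ℕ)
    (ht1 : 1 ≤ t) (htT : t ≤ T) (hBt : B ≤ t) :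
    -- the estimate is well defined and given by the closed form
    IsUnit (S.Psi j).det ∧
    IsUnit (crossMoment P (M.psi S j) (M.psi S j)).det ∧
    (∀ l m ω n, M.hhat P S j l m t ω n =
      ((S.filterRow j l m t ⊗ₖ (1 : Matrix (Fin N) (Fin N) ℂ)) *ᵥ M.psi S j ω) ((), n)) ∧
    -- squared norm
    Integrable (fun ω => ‖WithLp.toLp 2 (M.mrc P S j k t ω)‖ ^ 2) P ∧
    ((∫ ω, ‖WithLp.toLp 2 (M.mrc P S j k t ω)‖ ^ 2 ∂P : ℝ) : ℂ) =
      N * (S.lam j j k : ℂ) ^ 2 *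
        (star (S.pilot j k) ⬝ᵥ (S.D t * (S.Psi j)⁻¹ * (S.D t)ᴴ) *ᵥ S.pilot j k) ∧
    -- first moment
    Integrable (fun ω => star (M.mrc P S j k t ω) ⬝ᵥ M.effChan j j k t ω) P ∧
    ∫ ω, star (M.mrc P S j k t ω) ⬝ᵥ M.effChan j j k t ω ∂P =
      ((∫ ω, ‖WithLp.toLp 2 (M.mrc P S j k t ω)‖ ^ 2 ∂P : ℝ) : ℂ) ∧
    -- second moments
    (∀ l m,
      Integrable (fun ω => ‖star (M.mrc P S j k t ω) ⬝ᵥ M.effChan j l m t ω‖ ^ 2) P ∧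
      ((∫ ω, ‖star (M.mrc P S j k t ω) ⬝ᵥ M.effChan j l m t ω‖ ^ 2 ∂P : ℝ) : ℂ) =
        (S.lam j l m : ℂ) * ((∫ ω, ‖WithLp.toLp 2 (M.mrc P S j k t ω)‖ ^ 2 ∂P : ℝ) : ℂ) +
        N * (S.lam j j k : ℂ) ^ 2 * (S.lam j l m : ℂ) ^ 2 *
          (star (S.pilot j k) ⬝ᵥ
            (S.D t * (S.Psi j)⁻¹ * S.X l m * (S.Psi j)⁻¹ * (S.D t)ᴴ) *ᵥ S.pilot j k) +
        N * ((N : ℂ) - 1) * (S.lam j j k : ℂ) ^ 2 * (S.lam j l m : ℂ) ^ 2 *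
          ((‖star (S.pilot j k) ⬝ᵥ
            (S.D t * (S.Psi j)⁻¹ * (S.D t)ᴴ) *ᵥ S.pilot l m‖ ^ 2 : ℝ) : ℂ)) ∧
    -- distortion noise, at the channel uses after the pilot phase
    (B < t →
      Integrable (fun ω => ‖star (M.mrc P S j k t ω) ⬝ᵥ M.upsVec j t ω‖ ^ 2) P ∧
      ((∫ ω, ‖star (M.mrc P S j k t ω) ⬝ᵥ M.upsVec j t ω‖ ^ 2 ∂P : ℝ) : ℂ) =
        (S.kappa : ℂ) ^ 2 * ∑ l, ∑ m, (S.p l m : ℂ) * (S.lam j l m : ℂ) *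
          ((∫ ω, ‖WithLp.toLp 2 (M.mrc P S j k t ω)‖ ^ 2 ∂P : ℝ) : ℂ) +
        (S.kappa : ℂ) ^ 2 * ∑ l, ∑ m, (S.p l m : ℂ) *
          (N * (S.lam j j k : ℂ) ^ 2 * (S.lam j l m : ℂ) ^ 2 *
            (star (S.pilot j k) ⬝ᵥ
              (S.D t * (S.Psi j)⁻¹ * S.X l m * (S.Psi j)⁻¹ * (S.D t)ᴴ) *ᵥ S.pilot j k))) := by
  -- The channel uses `1, …, T` are indexed by `Fin T` from `0`.
  obtain ⟨s, rfl⟩ : ∃ s : Fin T, t = s + 1 := ⟨⟨t - 1, by omega⟩, by simp; omega⟩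
  have hBT : B ≤ T := hBt.trans htT
  have hnorm := integral_norm_sq_mrc hM hBT j k s hBt
  refine ⟨S.isUnit_det_Psi j, isUnit_det_crossMoment_psi hM hBT j,
    fun l m ω n => hhat_eq_filterRow hM hBT j (l, m) s hBt ω n,
    integrable_norm_sq_mrc hM hBT j k s hBt, hnorm, ?_, ?_, fun l m => ⟨?_, ?_⟩,
    fun hlt => ⟨?_, ?_⟩⟩
  · exact (hasAllMoments_star_mrc_dotProduct hM hBT j k s hBt
      fun n => hasAllMoments_effChan hM j (j, k) n s).integrable
  · rw [hnorm]
    exact integral_star_mrc_dotProduct_effChan hM hBT j k s hBt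
  · exact (hasAllMoments_star_mrc_dotProduct hM hBT j k s hBt
      fun n => hasAllMoments_effChan hM j (l, m) n s).normSq
  · rw [hnorm]
    exact integral_norm_sq_star_mrc_dotProduct_effChan hM hBT j k s hBt (l, m)
  · exact (hasAllMoments_star_mrc_dotProduct hM hBT j k s hBt
      fun n => hasAllMoments_upsVec hM j n s).normSq
  · rw [hnorm]
    exact integral_norm_sq_star_mrc_dotProduct_upsVec hM hBT j k s (by omega)
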